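/- **Conventions.** A mixed polynomial is a finite sum $p(x)=\sum_{\nu,\mu}c_{\nu,\mu}\,x^\nu\bar x^\mu$, $x\in\mathbb C^n$; its support is $\operatorname{supp}(p)=\{\nu+\mu : c_{\nu,\mu}\neq 0\}\subset\mathbb N^n$. An analytic family over an open set $\Delta\subset\mathbb C$ of mixed polynomials is a finite sum $P(t,x)=\sum_{\nu,\mu} c_{\nu,\mu}(t)\,x^\nu\bar x^\mu$ with $c_{\nu,\mu}$ analytic on $\Delta$; its support is $\{\nu+\mu : c_{\nu,\mu}\not\equiv 0 \text{ on } \Delta\}$. For a (family of) mixed polynomial(s) $p$: - the Newton polyhedron $\Gamma_+(p)$ is the convex hull of $\bigcup_{\alpha\in\operatorname{supp}(p)}(\alpha+\mathbb R^n_{\ge 0})$, and the Newton diagram $\Gamma(p)$ is the union of its compact faces; $\Gamma(p)$ is convenient if it meets every coordinate axis; $V(\Gamma(p))$ is the set of its vertices; - for $w\in\mathbb Q_{\ge0}^n$, $\mathrm{fil}_w(p)=\min_{\alpha\in\operatorname{supp}(p)}\sum_i w_i\alpha_i$ (and $+\infty$ if $p= 0$), and $w_*=\max_i w_i$; - a weight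 associated to an $(n-1)$-dimensional face $\sigma$ of $\Gamma_+(p)$ is a nonzero $w_\sigma\in\mathbb Q_{\ge 0}^n$ orthogonal to the affine hyperplane containing $\sigma$. A control function is a nonzero mixed polynomial $h$ such that $\Gamma(h)$ is convenient and, near the origin, $|h|\sim\rho_{\Gamma(h)}:=\sum_{\alpha\in V(\Gamma(h))}|x_1|^{\alpha_1}\cdots|x_n|^{\alpha_n}$ (each is bounded by a constant multiple of the other). A family $F_t:(\mathbb C^n,0)\to(\mathbb C,0)$, $t\in\Delta$, is Lipschitz trivial over $\Delta$ if every $t_0\in \Delta$ has a neighbourhood $V\subset\Delta$ with a continuous family of germs of bi-Lipschitz homeomorphisms $\varphi_t:(\mathbb C^n,0)\to(\mathbb C^n,0)$, $t\in V$, such that $F_t(\varphi_t(x))=F_{t_0}(x)$ for all $x$ in a neighbourhood of $0$ and all $t\in V$. **Theorem.** Let $\Delta\subset\mathbb C$ be open and let $F_t(x)=f(x)+t\,g(x)$, $t\in\Delta$, with $f,g\in\mathbb C[x_1,\dots,x_n]$, be a family of germs $(\mathbb C^n,0)\to(\mathbb C,0)$ with isolated singularity at $0$, all having the same Newton diagram.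 Let $$h_t(x)=h(t,x)=\sum_{i=1}^n P_i(t,x)\,\frac{\partial F_t}{\partial x_i}(x)$$ be an analytic family over $\Delta$ of control functions, where each $P_i$ is an analytic family over $\Delta$ of mixed polynomials, and suppose that the Newton diagram of $h_t$ is independent of $t$. Suppose that for every $(n-1)$-dimensional compact face $\sigma$ of $\Gamma_+(h)$, with an associated weight $w_\sigma$, and for every $i=1,\dots,n$, $$\mathrm{fil}_{w_\sigma}(g)+\mathrm{fil}_{w_\sigma}(P_i)-\mathrm{fil}_{w_\sigma}(h)-w_{\sigma,*}\ \ge\ 0 .$$ Then $F_t$ is Lipschitz trivial over $\Delta$. -/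

import Mathlib

open Filter Topology Asymptotics

noncomputable section

namespace LipNewton

/-- Mixed polynomials in `x₁, …, xₙ` and `x̄₁, …, x̄ₙ`: the variable `Sum.inl i` is `xᵢ`, the
variable `Sum.inr i` is `x̄ᵢ`. -/
abbrev MixedPoly (n : ℕ) : Type := MvPolynomial (Fin n ⊕ Fin n) ℂ

variable {n : ℕ}

/-- The function on `ℂⁿ` given by a mixed polynomial. -/
def MixedPoly.evalAt (p : MixedPoly n) (x : Fin n → ℂ) : ℂ :=
  MvPolynomial.eval (Sum.elim x (fun i => (starRingEnd ℂ) (x i))) p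

/-- A polynomial in `x`, seen as a mixed polynomial without the variables `x̄ᵢ`. -/
def toMixed (p : MvPolynomial (Fin n) ℂ) : MixedPoly n :=
  MvPolynomial.rename Sum.inl p

/-- The support of a mixed polynomial: the exponents `ν + μ` of the mixed monomials
`x^ν x̄^μ` that occur in it with a nonzero coefficient. -/
def mixedSupport (p : MixedPoly n) : Finset (Fin n → ℕ) :=
  p.support.image (fun m i => m (Sum.inl i) + m (Sum.inr i))

/-- An analytic family, over `Δ`, of mixed polynomials: a finite sum
`∑ c_{ν,μ}(t) x^ν x̄^μ` whose coefficients are analytic functions of `t ∈ Δ`. -/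
def IsAnalyticFamily (Δ : Set ℂ) (P : ℂ → MixedPoly n) : Prop :=
  (∃ S : Finset ((Fin n ⊕ Fin n) →₀ ℕ), ∀ t ∈ Δ, (P t).support ⊆ S) ∧
    ∀ m : (Fin n ⊕ Fin n) →₀ ℕ, AnalyticOnNhd ℂ (fun t => (P t).coeff m) Δ

/-- The support of a family over `Δ`: the exponents `ν + μ` such that the coefficient
`c_{ν,μ}(t)` is not identically zero on `Δ`. -/
def familySupport (Δ : Set ℂ) (P : ℂ → MixedPoly n) : Set (Fin n → ℕ) :=
  {α | ∃ t ∈ Δ, α ∈ mixedSupport (P t)}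

/-- The filtration with respect to the weight `w` of a (family of) mixed polynomial(s) with
support `A`; it is `+∞` if `A` is empty. -/
def fil (w : Fin n → ℚ) (A : Set (Fin n → ℕ)) : EReal :=
  ⨅ α ∈ A, ((∑ i, (w i : ℝ) * (α i : ℝ) : ℝ) : EReal)

/-- The largest coordinate `w_*` of a weight. -/
def maxWeight (w : Fin n → ℚ) : EReal := ⨆ i, (((w i : ℚ) : ℝ) : EReal)

/-- The Newton polyhedron: the convex hull of the union of the `α + ℝⁿ₊`, `α ∈ A`. -/
def newtonPolyhedron (A : Set (Fin n → ℕ)) : Set (Fin n → ℝ) :=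
  convexHull ℝ {x | ∃ α ∈ A, ∀ i, (α i : ℝ) ≤ x i}

/-- The compact (nonempty) faces of the Newton polyhedron. -/
def IsCompactFace (A : Set (Fin n → ℕ)) (σ : Set (Fin n → ℝ)) : Prop :=
  σ.Nonempty ∧ IsExposed ℝ (newtonPolyhedron A) σ ∧ IsCompact σ

/-- The compact faces of dimension `n - 1`. -/
def IsCompactFacet (A : Set (Fin n → ℕ)) (σ : Set (Fin n → ℝ)) : Prop :=
  IsCompactFace A σ ∧ Module.finrank ℝ (vectorSpan ℝ σ) + 1 = n

/-- The Newton diagram: the union of the compact faces of the Newton polyhedron. -/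
def newtonDiagram (A : Set (Fin n → ℕ)) : Set (Fin n → ℝ) :=
  {x | ∃ σ, IsCompactFace A σ ∧ x ∈ σ}

/-- The Newton diagram is convenient if it meets every coordinate axis. -/
def IsConvenient (A : Set (Fin n → ℕ)) : Prop :=
  ∀ i : Fin n, ∃ a : ℝ, Pi.single i a ∈ newtonDiagram A

/-- The vertices of the Newton diagram, i.e. of the Newton polyhedron. -/
def newtonVertices (A : Set (Fin n → ℕ)) : Set (Fin n → ℝ) :=
  (newtonPolyhedron A).extremePoints ℝ

/-- Every vertex is a point of the support. -/
theorem newtonVertices_subset (A : Set (Fin n → ℕ)) :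
    newtonVertices A ⊆ (fun (α : Fin n → ℕ) (i : Fin n) => (α i : ℝ)) '' A := by
  intro x hx
  obtain ⟨α, hα, hle⟩ := extremePoints_convexHull_subset hx
  refine ⟨α, hα, ?_⟩
  have h1 : (fun i => (α i : ℝ)) ∈ newtonPolyhedron A :=
    subset_convexHull ℝ _ ⟨α, hα, fun i => le_rfl⟩
  have h2 : (fun i => 2 * x i - (α i : ℝ)) ∈ newtonPolyhedron A :=
    subset_convexHull ℝ _ ⟨α, hα, fun i => by have := hle i; linarith⟩
  refine (mem_extremePoints.1 hx).2 _ h1 _ h2 ?_ |>.1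
  refine ⟨1 / 2, 1 / 2, by norm_num, by norm_num, by norm_num, ?_⟩
  ext i
  simp only [Pi.add_apply, Pi.smul_apply, smul_eq_mul]
  ring

/-- A weight associated to a facet `σ`: a nonzero vector with nonnegative rational coordinates
that is orthogonal to the affine hyperplane spanned by `σ`. -/
def IsWeight (σ : Set (Fin n → ℝ)) (w : Fin n → ℚ) : Prop :=
  w ≠ 0 ∧ (∀ i, 0 ≤ w i) ∧ ∃ d : ℝ, ∀ x ∈ σ, ∑ i, (w i : ℝ) * x i = d

open Classical in
/-- `ρ_{Γ(h)}(x) = ∑ |x₁|^{α₁} ⋯ |xₙ|^{αₙ}`, the sum over the vertices `α` of the Newton diagram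
of `h` (all of them belong to the support of `h`). -/
def rho (h : MixedPoly n) (x : Fin n → ℂ) : ℝ :=
  ∑ α ∈ (mixedSupport h).filter
      (fun α => (fun i => (α i : ℝ)) ∈ newtonVertices (mixedSupport h : Set (Fin n → ℕ))),
    ∏ i, ‖x i‖ ^ (α i)

/-- Control functions: nonzero mixed polynomials `h` whose Newton diagram is convenient and such
that `|h| ∼ ρ_{Γ(h)}` near the origin (each is bounded by a constant multiple of the other). -/
def IsControlFunction (h : MixedPoly n) : Prop :=
  h ≠ 0 ∧ IsConvenient (mixedSupport h : Set (Fin n → ℕ)) ∧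
    (fun x => h.evalAt x) =Θ[𝓝 (0 : Fin n → ℂ)] rho h

/-- The origin is an isolated critical point of `p`. -/
def HasIsolatedSingularity (p : MvPolynomial (Fin n) ℂ) : Prop :=
  (∀ i, MvPolynomial.eval 0 (MvPolynomial.pderiv i p) = 0) ∧
    ∀ᶠ x in 𝓝[≠] (0 : Fin n → ℂ), ∃ i, MvPolynomial.eval x (MvPolynomial.pderiv i p) ≠ 0

/-- `φ`, restricted to the open neighbourhood `W` of `0`, is a bi-Lipschitz homeomorphism onto an
open neighbourhood of `0` and fixes `0`. (All norms on `ℂⁿ` give the same notion.) -/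
def IsBiLipschitzGerm (W : Set (Fin n → ℂ)) (φ : (Fin n → ℂ) → (Fin n → ℂ)) : Prop :=
  φ 0 = 0 ∧ IsOpen (φ '' W) ∧
    ∃ K : ℝ, 0 < K ∧ ∀ x ∈ W, ∀ y ∈ W,
      ‖φ x - φ y‖ ≤ K * ‖x - y‖ ∧ ‖x - y‖ ≤ K * ‖φ x - φ y‖

/-- Lipschitz triviality over `U` of a family `F_t : (ℂⁿ, 0) → (ℂ, 0)`: near every `t₀ ∈ U` there
is a continuous family of germs of bi-Lipschitz homeomorphisms `φ_t` of `(ℂⁿ, 0)` with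
`F_t (φ_t x) = F_{t₀} x` for all `x` in a neighbourhood `W` of `0` and all `t` near `t₀`. -/
def IsLipschitzTrivial (U : Set ℂ) (F : ℂ → (Fin n → ℂ) → ℂ) : Prop :=
  ∀ t₀ ∈ U, ∃ V : Set ℂ, IsOpen V ∧ t₀ ∈ V ∧ V ⊆ U ∧
    ∃ W : Set (Fin n → ℂ), IsOpen W ∧ 0 ∈ W ∧
      ∃ φ : ℂ → (Fin n → ℂ) → (Fin n → ℂ),
        ContinuousOn (fun q : ℂ × (Fin n → ℂ) => φ q.1 q.2) (V ×ˢ W) ∧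
        (∀ t ∈ V, IsBiLipschitzGerm W (φ t)) ∧
        ∀ t ∈ V, ∀ x ∈ W, F t (φ t x) = F t₀ x

end LipNewton

end

/-!
Differentiating `F_t ∘ φ_t = F_{t₀}` in `t` shows that the trivialisation `φ_t` may be taken to be
the flow of a vector field `X` with `g + ∑ Xₖ ∂F_t/∂xₖ = 0`. Since `h_t = ∑ Pₖ ∂F_t/∂xₖ`, the
field with components `Xₖ = -g Pₖ / h_t` has this property (`eval_add_sum_trivField`), and all
that is needed is that it is Lipschitz in `x` near the origin, with a constant that is locally
uniform in `t`.

Let `ρ` be the sum of the absolute values of the vertex monomials of `h_{t₀}`, so that `|h_{t₀}| ∼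
ρ`. With `|xᵢ| = exp (-wᵢ)`, a monomial `x^α` has absolute value `exp (-(w · α))`, so it is
bounded by `ρ` as soon as no positive functional `w` separates `α` from the support of `h_{t₀}`;
this is the relation `LiesAbove`, and the bound is `prod_norm_pow_le_rho_pow`. Two facts from
polyhedral geometry make the relation usable. The Newton diagram determines the minima of all
positive functionals (`LiesAbove.of_newtonDiagram_eq`), so all monomials of the family `h` are
bounded by `ρ`; as the coefficients are continuous in `t`, the lower bound `|h_t| ≥ c ρ` spreads
from `t₀` to nearby parameters (`exists_uniform_lower_bound`). And, by convenience, a functional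
separating `α` can be replaced by one defining a compact facet (`exists_separating_facet`): a
vertex of the blocking polyhedron `{w | ∀ β ∈ A, 1 ≤ w · β}` is such a functional, because the
exponents on which it equals `1` span the space.

The hypothesis on the filtrations therefore says that `∂(g Pₖ) = O(ρ)` and `g Pₖ ∂h = O(ρ²)`
(`exists_numerator_bounds`), which bounds the derivative of `g Pₖ / h` away from the origin; since
also `g Pₖ / h = O(|x|)`, the quotient is Lipschitz on a ball (`norm_evalAt_div_sub_le`). Finally,
Picard–Lindelöf and Grönwall give the flow as a continuous family of bi-Lipschitz germs
(`exists_isBiLipschitzGerm_family`), along which the family `F` is constant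
(`eval_eq_of_integralCurve`).
-/

noncomputable section

namespace LipNewton

variable {n : ℕ}

/-! ### Linear functionals on Newton polyhedra -/

/-- An exponent, seen as a real vector. -/
def realExp (α : Fin n → ℕ) : Fin n → ℝ := fun i => (α i : ℝ)

theorem realExp_nonneg (α : Fin n → ℕ) : 0 ≤ realExp α := fun i => Nat.cast_nonneg (α i)

theorem realExp_mem_newtonPolyhedron {A : Set (Fin n → ℕ)} {α : Fin n → ℕ} (hα : α ∈ A) :
    realExp α ∈ newtonPolyhedron A :=
  subset_convexHull ℝ _ ⟨α, hα, fun _ => le_rfl⟩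

theorem isLinearMap_dotProduct (w : Fin n → ℝ) : IsLinearMap ℝ (fun x : Fin n → ℝ => w ⬝ᵥ x) :=
  ⟨fun x y => dotProduct_add w x y, fun c x => dotProduct_smul c w x⟩

theorem continuous_dotProduct_right (w : Fin n → ℝ) :
    Continuous (fun x : Fin n → ℝ => w ⬝ᵥ x) := by
  unfold dotProduct
  fun_prop

theorem continuous_dotProduct_left (x : Fin n → ℝ) :
    Continuous (fun w : Fin n → ℝ => w ⬝ᵥ x) := by
  unfold dotProduct
  fun_prop

open scoped Pointwise in
theorem newtonPolyhedron_eq_add (A : Set (Fin n → ℕ)) :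
    newtonPolyhedron A = convexHull ℝ (realExp '' A) + Set.Ici (0 : Fin n → ℝ) := by
  have h : {x : Fin n → ℝ | ∃ α ∈ A, ∀ i, (α i : ℝ) ≤ x i} =
      realExp '' A + Set.Ici (0 : Fin n → ℝ) := by
    ext x
    constructor
    · rintro ⟨α, hα, hle⟩
      exact Set.mem_add.2 ⟨realExp α, ⟨α, hα, rfl⟩, x - realExp α,
        fun i => sub_nonneg.2 (hle i), by simp⟩
    · rintro ⟨_, ⟨α, hα, rfl⟩, y, hy, rfl⟩
      exact ⟨α, hα, fun i => le_add_of_nonneg_right (hy i)⟩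
  rw [newtonPolyhedron, h, convexHull_add, (convex_Ici (0 : Fin n → ℝ)).convexHull_eq]

theorem isClosed_newtonPolyhedron {A : Set (Fin n → ℕ)} (hA : A.Finite) :
    IsClosed (newtonPolyhedron A) := by
  rw [newtonPolyhedron_eq_add]
  exact isClosed_Ici.add_left_of_isCompact ((hA.image realExp).isCompact_convexHull (𝕜 := ℝ))

theorem le_dotProduct_of_mem_newtonPolyhedron {A : Set (Fin n → ℕ)} {w : Fin n → ℝ}
    (hw : 0 ≤ w) {c : ℝ} (hc : ∀ β ∈ A, c ≤ w ⬝ᵥ realExp β) {x : Fin n → ℝ}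
    (hx : x ∈ newtonPolyhedron A) : c ≤ w ⬝ᵥ x := by
  refine convexHull_min ?_ (convex_halfSpace_ge (isLinearMap_dotProduct w) c) hx
  rintro y ⟨β, hβ, hle⟩
  exact (hc β hβ).trans (dotProduct_le_dotProduct_of_nonneg_left hle hw)

theorem nonneg_of_mem_newtonPolyhedron {A : Set (Fin n → ℕ)} {x : Fin n → ℝ}
    (hx : x ∈ newtonPolyhedron A) : 0 ≤ x := by
  refine convexHull_min (t := Set.Ici (0 : Fin n → ℝ)) ?_ (convex_Ici 0) hx
  rintro y ⟨β, -, hle⟩ i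
  exact (Nat.cast_nonneg (β i)).trans (hle i)

/-- A linear functional with positive coefficients exposes a compact face: the functional is
bounded on that face, hence so are the (nonnegative) coordinates. -/
theorem isCompactFace_of_forall_le {A : Set (Fin n → ℕ)} (hA : A.Finite) {w : Fin n → ℝ}
    (hw : ∀ i, 0 < w i) {β : Fin n → ℕ} (hβ : β ∈ A)
    (hmin : ∀ γ ∈ A, w ⬝ᵥ realExp β ≤ w ⬝ᵥ realExp γ) :
    IsCompactFace A {x ∈ newtonPolyhedron A | w ⬝ᵥ x = w ⬝ᵥ realExp β} := by
  have hw0 : 0 ≤ w := fun i => (hw i).le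
  have hle := fun x hx => le_dotProduct_of_mem_newtonPolyhedron (x := x) hw0 hmin hx
  refine ⟨⟨realExp β, realExp_mem_newtonPolyhedron hβ, rfl⟩, fun _ => ?_, ?_⟩
  · refine ⟨-LinearMap.toContinuousLinearMap (isLinearMap_dotProduct w).mk', ?_⟩
    ext x
    simp only [Set.mem_ofPred_eq, _root_.neg_apply, neg_le_neg_iff]
    refine and_congr_right fun hx => ⟨fun h y hy => ?_, fun h => ?_⟩
    · exact h.trans_le (hle y hy)
    · exact le_antisymm (h _ (realExp_mem_newtonPolyhedron hβ)) (hle x hx)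
  · refine (isCompact_Icc (a := (0 : Fin n → ℝ))
      (b := fun i => w ⬝ᵥ realExp β / w i)).of_isClosed_subset ?_ ?_
    · exact (isClosed_newtonPolyhedron hA).inter
        (isClosed_eq (continuous_dotProduct_right w) continuous_const)
    · rintro x ⟨hx, hxw⟩
      have hx0 := nonneg_of_mem_newtonPolyhedron hx
      refine ⟨hx0, fun i => ?_⟩
      rw [le_div_iff₀ (hw i), ← hxw, mul_comm]
      exact Finset.single_le_sum (f := fun j => w j * x j)
        (fun j _ => mul_nonneg (hw0 j) (hx0 j)) (Finset.mem_univ i)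

theorem exists_newtonVertex_forall_le {A : Set (Fin n → ℕ)} (hA : A.Finite) (hne : A.Nonempty)
    {w : Fin n → ℝ} (hw : ∀ i, 0 < w i) :
    ∃ α ∈ A, realExp α ∈ newtonVertices A ∧ ∀ γ ∈ A, w ⬝ᵥ realExp α ≤ w ⬝ᵥ realExp γ := by
  obtain ⟨β, hβ, hmin⟩ := Set.exists_min_image A (fun γ => w ⬝ᵥ realExp γ) hA hne
  obtain ⟨hne', hexp, hcomp⟩ := isCompactFace_of_forall_le hA hw hβ hmin
  obtain ⟨x, hx⟩ := hcomp.extremePoints_nonempty hne'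
  have hxA := hexp.isExtreme.extremePoints_subset_extremePoints hx
  obtain ⟨α, hα, rfl⟩ := newtonVertices_subset A hxA
  exact ⟨α, hα, hxA, fun γ hγ => (hx.1.2 : w ⬝ᵥ realExp α = _).trans_le (hmin γ hγ)⟩

/-- `α` lies above `A` if no linear functional with positive coefficients separates `α` from `A`.
For finite nonempty `A` this says that `α` lies in the Newton polyhedron of `A`. -/
def LiesAbove (A : Set (Fin n → ℕ)) (α : Fin n → ℝ) : Prop :=
  ∀ w : Fin n → ℝ, (∀ i, 0 < w i) → ∃ β ∈ A, w ⬝ᵥ realExp β ≤ w ⬝ᵥ α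

theorem LiesAbove.of_mem {A : Set (Fin n → ℕ)} {α : Fin n → ℕ} (hα : α ∈ A) :
    LiesAbove A (realExp α) :=
  fun _ _ => ⟨α, hα, le_rfl⟩

theorem LiesAbove.trans {A B : Set (Fin n → ℕ)} (hB : ∀ β ∈ B, LiesAbove A (realExp β))
    {α : Fin n → ℝ} (hα : LiesAbove B α) : LiesAbove A α := by
  intro w hw
  obtain ⟨β, hβ, hle⟩ := hα w hw
  obtain ⟨γ, hγ, hle'⟩ := hB β hβ w hw
  exact ⟨γ, hγ, hle'.trans hle⟩

/-- The Newton diagram determines the minimum of every functional with positive coefficients,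
because that minimum is attained on a compact face. -/
theorem LiesAbove.of_newtonDiagram_eq {A B : Set (Fin n → ℕ)} (hA : A.Finite) (hne : A.Nonempty)
    (hB : B.Finite) (h : newtonDiagram B = newtonDiagram A) {β : Fin n → ℕ} (hβ : β ∈ B) :
    LiesAbove A (realExp β) := by
  intro w hw
  obtain ⟨α, hα, hminA⟩ := Set.exists_min_image A (fun γ => w ⬝ᵥ realExp γ) hA hne
  obtain ⟨β₀, hβ₀, hminB⟩ := Set.exists_min_image B (fun γ => w ⬝ᵥ realExp γ) hB ⟨β, hβ⟩
  have hmem : realExp β₀ ∈ newtonDiagram B :=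
    ⟨_, isCompactFace_of_forall_le hB hw hβ₀ hminB, realExp_mem_newtonPolyhedron hβ₀, rfl⟩
  rw [h] at hmem
  obtain ⟨σ, ⟨-, hexp, -⟩, hmem⟩ := hmem
  exact ⟨α, hα, (le_dotProduct_of_mem_newtonPolyhedron (fun i => (hw i).le) hminA
    (hexp.subset hmem)).trans (hminB β hβ)⟩

theorem IsConvenient.exists_single_mem {A : Set (Fin n → ℕ)} (hA : IsConvenient A) (i : Fin n) :
    ∃ k : ℕ, Pi.single i k ∈ A := by
  obtain ⟨a, σ, ⟨-, hexp, -⟩, hmem⟩ := hA i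
  have ha := hexp.subset hmem
  by_contra! hno
  -- The sum of the coordinates other than the `i`-th would be at least `1` on the polyhedron.
  have h1 : ∀ β ∈ A, (1 : ℝ) ≤ (fun j => if j = i then (0 : ℝ) else 1) ⬝ᵥ realExp β := by
    intro β hβ
    obtain ⟨j, hj⟩ : ∃ j, j ≠ i ∧ β j ≠ 0 := by
      by_contra! hz
      refine hno (β i) ?_
      convert hβ
      ext j
      by_cases hj : j = i
      · subst hj; simp
      · simp [hj, hz j hj]
    refine le_trans ?_ (Finset.single_le_sum
      (f := fun j => (if j = i then (0 : ℝ) else 1) * realExp β j) (fun j _ => ?_)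
      (Finset.mem_univ j))
    · simpa [hj.1, realExp] using Nat.one_le_iff_ne_zero.2 hj.2
    · exact mul_nonneg (by split_ifs <;> norm_num) (realExp_nonneg β j)
  have h2 := le_dotProduct_of_mem_newtonPolyhedron
    (fun j => by show (0 : ℝ) ≤ if j = i then 0 else 1; split_ifs <;> norm_num) h1 ha
  simp [dotProduct_single] at h2
  linarith

/-! ### Facets of a convenient Newton polyhedron -/

/-- At an extreme point of a face of the blocking polyhedron `{w | ∀ β ∈ A, 1 ≤ w · β}` on which a
linear functional is minimal, the active constraints span the whole space. -/
theorem span_active_eq_top {A : Set (Fin n → ℕ)} (hA : A.Finite) {a : Fin n → ℝ} {m : ℝ}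
    (hm : ∀ w : Fin n → ℝ, (∀ β ∈ A, 1 ≤ w ⬝ᵥ realExp β) → m ≤ w ⬝ᵥ a) {w : Fin n → ℝ}
    (hw : w ∈ Set.extremePoints ℝ
      {w : Fin n → ℝ | (∀ β ∈ A, 1 ≤ w ⬝ᵥ realExp β) ∧ w ⬝ᵥ a = m}) :
    Submodule.span ℝ (realExp '' {β ∈ A | w ⬝ᵥ realExp β = 1}) = ⊤ := by
  by_contra hne
  obtain ⟨f, hf0, hf⟩ := Submodule.exists_le_ker_of_lt_top _ (lt_top_iff_ne_top.2 hne)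
  obtain ⟨u, rfl⟩ := (dotProductEquiv ℝ (Fin n)).surjective f
  have hu : ∀ β ∈ A, w ⬝ᵥ realExp β = 1 → u ⬝ᵥ realExp β = 0 := fun β hβ h1 =>
    LinearMap.mem_ker.1 (hf (Submodule.subset_span ⟨β, ⟨hβ, h1⟩, rfl⟩))
  have hev : ∀ᶠ δ : ℝ in 𝓝[>] 0, ∀ β ∈ A, δ * |u ⬝ᵥ realExp β| ≤ w ⬝ᵥ realExp β - 1 := by
    rw [eventually_all_finite hA]
    intro β hβ
    rcases (hw.1.1 β hβ).eq_or_lt with h1 | h1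
    · simp [hu β hβ h1.symm, ← h1]
    · have : Tendsto (fun δ : ℝ => δ * |u ⬝ᵥ realExp β|) (𝓝[>] 0) (𝓝 (0 * |u ⬝ᵥ realExp β|)) :=
        (tendsto_id.mono_left nhdsWithin_le_nhds).mul_const _
      rw [zero_mul] at this
      exact (this.eventually_lt_const (sub_pos.2 h1)).mono fun _ h => h.le
  obtain ⟨δ, hδ, hδ0⟩ := (hev.and self_mem_nhdsWithin).exists
  have hδ0 : 0 < δ := hδ0
  have hp : ∀ β ∈ A, 1 ≤ (w + δ • u) ⬝ᵥ realExp β := by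
    intro β hβ
    have h1 := hδ β hβ
    have h2 := mul_le_mul_of_nonneg_left (neg_abs_le (u ⬝ᵥ realExp β)) hδ0.le
    simp only [add_dotProduct, smul_dotProduct, smul_eq_mul]
    linarith
  have hq : ∀ β ∈ A, 1 ≤ (w - δ • u) ⬝ᵥ realExp β := by
    intro β hβ
    have h1 := hδ β hβ
    have h2 := mul_le_mul_of_nonneg_left (le_abs_self (u ⬝ᵥ realExp β)) hδ0.le
    simp only [sub_dotProduct, smul_dotProduct, smul_eq_mul]
    linarith
  have hp' := hm _ hp
  have hq' := hm _ hq
  have hwa := hw.1.2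
  simp only [add_dotProduct, sub_dotProduct, smul_dotProduct, smul_eq_mul] at hp' hq'
  have h0 : δ * (u ⬝ᵥ a) = 0 := by linarith
  have heq := ((mem_extremePoints.1 hw).2 (w + δ • u)
    ⟨hp, by simp [add_dotProduct, smul_dotProduct, h0, hwa]⟩ (w - δ • u)
    ⟨hq, by simp [sub_dotProduct, smul_dotProduct, h0, hwa]⟩
    ⟨1 / 2, 1 / 2, by norm_num, by norm_num, by norm_num, by
      ext i; simp only [Pi.add_apply, Pi.smul_apply, Pi.sub_apply, smul_eq_mul]; ring⟩).1
  have hu0 : u = 0 := by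
    simpa [hδ0.ne'] using heq
  exact hf0 (by rw [hu0, map_zero])

/-- If `w` is bounded below by `1` on `A` and the exponents of `A` where `w` takes the value `1`
span the space, then the level `1` of `w` is a facet. -/
theorem isCompactFacet_of_span_eq_top {A : Set (Fin n → ℕ)} (hA : A.Finite) (hn : n ≠ 0)
    {w : Fin n → ℝ} (hw : ∀ i, 0 < w i) (hA1 : ∀ β ∈ A, 1 ≤ w ⬝ᵥ realExp β)
    (hspan : Submodule.span ℝ (realExp '' {β ∈ A | w ⬝ᵥ realExp β = 1}) = ⊤) :
    IsCompactFacet A {x ∈ newtonPolyhedron A | w ⬝ᵥ x = 1} := by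
  have hfin : Module.finrank ℝ (Fin n → ℝ) = n := by simp
  obtain ⟨β, hβ, hβ1⟩ : ∃ β, β ∈ A ∧ w ⬝ᵥ realExp β = 1 := by
    by_contra! hno
    have : {β ∈ A | w ⬝ᵥ realExp β = 1} = ∅ := by
      ext β; simpa using hno β
    rw [this, Set.image_empty, Submodule.span_empty] at hspan
    rw [← finrank_top ℝ, ← hspan, finrank_bot] at hfin
    exact hn hfin.symm
  have hface := isCompactFace_of_forall_le hA hw hβ (fun γ hγ => hβ1.trans_le (hA1 γ hγ))
  rw [hβ1] at hface
  refine ⟨hface, ?_⟩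
  set σ : Set (Fin n → ℝ) := {x ∈ newtonPolyhedron A | w ⬝ᵥ x = 1} with hσ
  have hβσ : realExp β ∈ σ := ⟨realExp_mem_newtonPolyhedron hβ, hβ1⟩
  apply le_antisymm
  · have hker : vectorSpan ℝ σ ≤ LinearMap.ker (dotProductEquiv ℝ (Fin n) w) := by
      rw [vectorSpan_def, Submodule.span_le]
      rintro _ ⟨x, hx, y, hy, rfl⟩
      have : w ⬝ᵥ (x - y) = 0 := by rw [dotProduct_sub, hx.2, hy.2, sub_self]
      simpa using this
    have hlt : vectorSpan ℝ σ < ⊤ := by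
      refine lt_of_le_of_lt hker (lt_top_iff_ne_top.2 fun h => ?_)
      have h1 : realExp β ∈ LinearMap.ker (dotProductEquiv ℝ (Fin n) w) := h ▸ Submodule.mem_top
      have h2 : w ⬝ᵥ realExp β = 0 := by simpa using h1
      rw [h2] at hβ1
      exact zero_ne_one hβ1
    have := Submodule.finrank_lt_finrank_of_lt hlt
    rw [finrank_top, hfin] at this
    exact this
  · have hle : (⊤ : Submodule ℝ (Fin n → ℝ)) ≤ Submodule.span ℝ {realExp β} ⊔ vectorSpan ℝ σ := by
      rw [← hspan, Submodule.span_le]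
      rintro _ ⟨γ, ⟨hγ, hγ1⟩, rfl⟩
      have h1 : realExp γ - realExp β ∈ vectorSpan ℝ σ :=
        vsub_mem_vectorSpan ℝ ⟨realExp_mem_newtonPolyhedron hγ, hγ1⟩ hβσ
      have := Submodule.add_mem_sup (Submodule.mem_span_singleton_self (R := ℝ) (realExp β)) h1
      simpa using this
    have h1 := Submodule.finrank_mono hle
    have h2 := Submodule.finrank_add_le_finrank_add_finrank
      (Submodule.span ℝ {realExp β}) (vectorSpan ℝ σ)
    have h3 := finrank_span_le_card (R := ℝ) ({realExp β} : Set (Fin n → ℝ))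
    rw [finrank_top, hfin] at h1
    simp at h3
    omega

/-- If a functional with positive coefficients separates `α` from `A`, then so does one defining a
compact facet: minimise a perturbation of `w ↦ w · α` over the blocking polyhedron
`{w | ∀ β ∈ A, 1 ≤ w · β}` and take a vertex. Convenience makes all coordinates positive there. -/
theorem exists_separating_facet {A : Set (Fin n → ℕ)} (hA : A.Finite) (hne : A.Nonempty)
    (haxis : ∀ i, ∃ k : ℕ, Pi.single i k ∈ A) {α : Fin n → ℝ} (hα : 0 ≤ α) {w₀ : Fin n → ℝ}
    (hw₀ : ∀ i, 0 < w₀ i) (hsep : ∀ β ∈ A, w₀ ⬝ᵥ α < w₀ ⬝ᵥ realExp β) :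
    ∃ w : Fin n → ℝ, (∀ i, 0 < w i) ∧ (∀ β ∈ A, 1 ≤ w ⬝ᵥ realExp β) ∧ w ⬝ᵥ α < 1 ∧
      Submodule.span ℝ (realExp '' {β ∈ A | w ⬝ᵥ realExp β = 1}) = ⊤ ∧
      IsCompactFacet A {x ∈ newtonPolyhedron A | w ⬝ᵥ x = 1} := by
  obtain ⟨β₀, hβ₀, hmin⟩ := Set.exists_min_image A (fun γ => w₀ ⬝ᵥ realExp γ) hA hne
  have hn : n ≠ 0 := by
    rintro rfl
    simpa [dotProduct] using hsep β₀ hβ₀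
  set c := w₀ ⬝ᵥ realExp β₀ with hc
  have hα0 : 0 ≤ w₀ ⬝ᵥ α := dotProduct_nonneg_of_nonneg (fun i => (hw₀ i).le) hα
  have hc0 : 0 < c := hα0.trans_lt (hsep β₀ hβ₀)
  set w₁ := c⁻¹ • w₀ with hw₁
  have hw₁pos : ∀ i, 0 < w₁ i := fun i => mul_pos (inv_pos.2 hc0) (hw₀ i)
  have hw₁A : ∀ β ∈ A, 1 ≤ w₁ ⬝ᵥ realExp β := by
    intro β hβ
    rw [hw₁, smul_dotProduct, smul_eq_mul, ← inv_mul_cancel₀ hc0.ne']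
    exact mul_le_mul_of_nonneg_left (hmin β hβ) (inv_nonneg.2 hc0.le)
  have hw₁α : w₁ ⬝ᵥ α < 1 := by
    rw [hw₁, smul_dotProduct, smul_eq_mul, ← inv_mul_cancel₀ hc0.ne']
    exact mul_lt_mul_of_pos_left (hsep β₀ hβ₀) (inv_pos.2 hc0)
  have hs : 0 ≤ w₁ ⬝ᵥ (1 : Fin n → ℝ) :=
    dotProduct_nonneg_of_nonneg (fun i => (hw₁pos i).le) (fun _ => zero_le_one)
  obtain ⟨ε, hε, hεlt⟩ : ∃ ε : ℝ, 0 < ε ∧ w₁ ⬝ᵥ α + ε * (w₁ ⬝ᵥ (1 : Fin n → ℝ)) < 1 := by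
    refine ⟨(1 - w₁ ⬝ᵥ α) / (w₁ ⬝ᵥ (1 : Fin n → ℝ) + 1), by
      apply div_pos <;> linarith, ?_⟩
    rw [div_mul_eq_mul_div, ← lt_sub_iff_add_lt', div_lt_iff₀ (by linarith)]
    exact mul_lt_mul_of_pos_left (by linarith) (by linarith)
  set a : Fin n → ℝ := α + ε • 1 with ha
  have hdot : ∀ w : Fin n → ℝ, w ⬝ᵥ a = w ⬝ᵥ α + ε * (w ⬝ᵥ (1 : Fin n → ℝ)) := fun w => by
    rw [ha, dotProduct_add, dotProduct_smul, smul_eq_mul]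
  have hQpos : ∀ w : Fin n → ℝ, (∀ β ∈ A, 1 ≤ w ⬝ᵥ realExp β) → ∀ i, 0 < w i := by
    intro w hw i
    obtain ⟨k, hk⟩ := haxis i
    have h1 := hw _ hk
    have h2 : realExp (Pi.single i k) = Pi.single i (k : ℝ) := by
      ext j
      by_cases hj : j = i
      · subst hj; simp [realExp]
      · simp [realExp, hj]
    rw [h2, dotProduct_single] at h1
    by_contra! hneg
    have := mul_nonpos_of_nonpos_of_nonneg hneg (Nat.cast_nonneg (α := ℝ) k)
    linarith
  have hQclosed : IsClosed {w : Fin n → ℝ | ∀ β ∈ A, 1 ≤ w ⬝ᵥ realExp β} := by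
    simp only [Set.ofPred_forall]
    exact isClosed_biInter fun β _ =>
      isClosed_le continuous_const (continuous_dotProduct_left _)
  have hMcomp : IsCompact {w : Fin n → ℝ | (∀ β ∈ A, 1 ≤ w ⬝ᵥ realExp β) ∧
      w ⬝ᵥ a ≤ w₁ ⬝ᵥ a} := by
    refine (isCompact_Icc (a := (0 : Fin n → ℝ))
      (b := fun _ => w₁ ⬝ᵥ a / ε)).of_isClosed_subset
      (hQclosed.inter (isClosed_le (continuous_dotProduct_left _) continuous_const)) ?_
    rintro w ⟨hw, hwa⟩
    have hw0 := hQpos w hw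
    refine ⟨fun i => (hw0 i).le, fun i => ?_⟩
    rw [le_div_iff₀ hε]
    refine le_trans ?_ hwa
    refine le_trans ?_ (Finset.single_le_sum (f := fun j => w j * a j)
      (fun j _ => mul_nonneg (hw0 j).le ?_) (Finset.mem_univ i))
    · refine mul_le_mul_of_nonneg_left ?_ (hw0 i).le
      have := hα i
      simpa [ha] using this
    · have := hα j
      simp only [ha, Pi.add_apply, Pi.smul_apply, Pi.one_apply, smul_eq_mul, mul_one]
      exact add_nonneg this hε.le
  obtain ⟨w₂, hw₂, hw₂min⟩ := hMcomp.exists_isMinOn ⟨w₁, hw₁A, le_rfl⟩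
    (continuous_dotProduct_left a).continuousOn
  have hm : ∀ w : Fin n → ℝ, (∀ β ∈ A, 1 ≤ w ⬝ᵥ realExp β) → w₂ ⬝ᵥ a ≤ w ⬝ᵥ a := by
    intro w hw
    rcases le_total (w ⬝ᵥ a) (w₁ ⬝ᵥ a) with h | h
    · exact hw₂min ⟨hw, h⟩
    · exact hw₂.2.trans h
  have hFcomp : IsCompact {w : Fin n → ℝ | (∀ β ∈ A, 1 ≤ w ⬝ᵥ realExp β) ∧
      w ⬝ᵥ a = w₂ ⬝ᵥ a} :=
    hMcomp.of_isClosed_subset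
      (hQclosed.inter (isClosed_eq (continuous_dotProduct_left _) continuous_const))
      fun w hw => ⟨hw.1, hw.2.trans_le hw₂.2⟩
  obtain ⟨w, hw⟩ := hFcomp.extremePoints_nonempty ⟨w₂, hw₂.1, rfl⟩
  have hwpos := hQpos w hw.1.1
  have hspan := span_active_eq_top hA hm hw
  refine ⟨w, hwpos, hw.1.1, ?_, hspan, isCompactFacet_of_span_eq_top hA hn hwpos hw.1.1 hspan⟩
  have h1 : w ⬝ᵥ a < 1 := by
    rw [hw.1.2]
    exact hw₂.2.trans_lt (by rw [hdot]; exact hεlt)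
  have h2 : 0 ≤ w ⬝ᵥ (1 : Fin n → ℝ) :=
    dotProduct_nonneg_of_nonneg (fun i => (hwpos i).le) (fun _ => zero_le_one)
  rw [hdot] at h1
  have := mul_nonneg hε.le h2
  linarith

/-- In the convenient case it suffices to test points on the weights of the compact facets. -/
theorem LiesAbove.of_facets {A : Set (Fin n → ℕ)} (hA : A.Finite) (hne : A.Nonempty)
    (haxis : ∀ i, ∃ k : ℕ, Pi.single i k ∈ A) {α : Fin n → ℝ} (hα : 0 ≤ α)
    (h : ∀ σ, IsCompactFacet A σ → ∃ w : Fin n → ℚ, IsWeight σ w ∧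
      ∃ β ∈ A, (fun i => (w i : ℝ)) ⬝ᵥ realExp β ≤ (fun i => (w i : ℝ)) ⬝ᵥ α) :
    LiesAbove A α := by
  intro w₀ hw₀
  by_contra! hsep
  obtain ⟨w, hwpos, hwA, hwα, hspan, hfacet⟩ := exists_separating_facet hA hne haxis hα hw₀ hsep
  obtain ⟨v, ⟨hv0, hvnn, d, hd⟩, β, hβ, hle⟩ := h _ hfacet
  set v' : Fin n → ℝ := fun i => (v i : ℝ) with hv'
  -- Both `v'` and `w` are constant on a set spanning the space, so they are proportional.
  have hprop : v' = d • w := by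
    have hker : (⊤ : Submodule ℝ (Fin n → ℝ)) ≤
        LinearMap.ker (dotProductEquiv ℝ (Fin n) (v' - d • w)) := by
      rw [← hspan, Submodule.span_le]
      rintro _ ⟨γ, ⟨hγ, hγ1⟩, rfl⟩
      have h1 : v' ⬝ᵥ realExp γ = d := hd _ ⟨realExp_mem_newtonPolyhedron hγ, hγ1⟩
      have : (v' - d • w) ⬝ᵥ realExp γ = 0 := by
        rw [sub_dotProduct, smul_dotProduct, h1, hγ1, smul_eq_mul, mul_one, sub_self]
      simpa using this
    have h0 : dotProductEquiv ℝ (Fin n) (v' - d • w) = 0 :=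
      LinearMap.ker_eq_top.1 (top_le_iff.1 hker)
    exact sub_eq_zero.1 ((LinearEquiv.map_eq_zero_iff _).1 h0)
  have hdpos : 0 < d := by
    obtain ⟨i, hi⟩ := Function.ne_iff.1 hv0
    have h1 : 0 < v' i := by
      have : 0 < v i := lt_of_le_of_ne (hvnn i) (Ne.symm hi)
      simp only [hv']
      exact_mod_cast this
    rw [hprop] at h1
    exact pos_of_mul_pos_left h1 (hwpos i).le
  rw [hprop, smul_dotProduct, smul_dotProduct, smul_eq_mul, smul_eq_mul] at hle
  have := le_of_mul_le_mul_left hle hdpos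
  linarith [hwA β hβ]

/-! ### Monomial estimates -/

/-- With `w i = -log (r i)`, a monomial with exponent `e` takes at `r` the value `exp (-(w · e))`,
so the largest monomial with exponent in `A` is the one that minimises `w`. -/
theorem prod_pow_le_sum_prod_pow_of_pos {A : Set (Fin n → ℕ)} {V : Finset (Fin n → ℕ)}
    (hV : ∀ w : Fin n → ℝ, (∀ i, 0 < w i) →
      ∃ α ∈ V, ∀ γ ∈ A, w ⬝ᵥ realExp α ≤ w ⬝ᵥ realExp γ)
    {e : Fin n → ℕ} {k : ℕ} (hk : k ≠ 0) (he : LiesAbove A (fun i => (e i : ℝ) / k))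
    {r : Fin n → ℝ} (hr0 : ∀ i, 0 < r i) (hr1 : ∀ i, r i < 1) :
    ∏ i, r i ^ e i ≤ (∑ α ∈ V, ∏ i, r i ^ α i) ^ k := by
  set w : Fin n → ℝ := fun i => -Real.log (r i) with hw
  have hwpos : ∀ i, 0 < w i := fun i => neg_pos.2 (Real.log_neg (hr0 i) (hr1 i))
  have hmono : ∀ α : Fin n → ℕ, ∏ i, r i ^ α i = Real.exp (-(w ⬝ᵥ realExp α)) := by
    intro α
    rw [dotProduct, ← Finset.sum_neg_distrib, Real.exp_sum]
    refine Finset.prod_congr rfl fun i _ => ?_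
    have : -(w i * realExp α i) = (α i : ℝ) * Real.log (r i) := by
      simp only [hw, realExp]; ring
    rw [this, Real.exp_nat_mul, Real.exp_log (hr0 i)]
  obtain ⟨α, hα, hmin⟩ := hV w hwpos
  obtain ⟨γ, hγ, hle⟩ := he w hwpos
  have hk0 : (0 : ℝ) < k := Nat.cast_pos.2 (Nat.pos_of_ne_zero hk)
  have hdiv : (k : ℝ) * (w ⬝ᵥ fun i => (e i : ℝ) / k) = w ⬝ᵥ realExp e := by
    simp only [dotProduct, Finset.mul_sum, realExp]
    refine Finset.sum_congr rfl fun i _ => ?_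
    field_simp
  calc ∏ i, r i ^ e i = Real.exp (-(w ⬝ᵥ realExp e)) := hmono e
    _ ≤ Real.exp ((k : ℝ) * -(w ⬝ᵥ realExp α)) := by
        rw [Real.exp_le_exp, ← hdiv, mul_neg, neg_le_neg_iff]
        exact mul_le_mul_of_nonneg_left ((hmin γ hγ).trans hle) hk0.le
    _ = (∏ i, r i ^ α i) ^ k := by rw [Real.exp_nat_mul, hmono]
    _ ≤ _ := by
        refine pow_le_pow_left₀ (Finset.prod_nonneg fun i _ => pow_nonneg (hr0 i).le _) ?_ k
        exact Finset.single_le_sum (f := fun α : Fin n → ℕ => ∏ i, r i ^ α i)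
          (fun α _ => Finset.prod_nonneg fun i _ => pow_nonneg (hr0 i).le _) hα

theorem prod_pow_le_sum_prod_pow {A : Set (Fin n → ℕ)} {V : Finset (Fin n → ℕ)}
    (hV : ∀ w : Fin n → ℝ, (∀ i, 0 < w i) →
      ∃ α ∈ V, ∀ γ ∈ A, w ⬝ᵥ realExp α ≤ w ⬝ᵥ realExp γ)
    {e : Fin n → ℕ} {k : ℕ} (hk : k ≠ 0) (he : LiesAbove A (fun i => (e i : ℝ) / k))
    {r : Fin n → ℝ} (hr0 : ∀ i, 0 ≤ r i) (hr1 : ∀ i, r i < 1) :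
    ∏ i, r i ^ e i ≤ (∑ α ∈ V, ∏ i, r i ^ α i) ^ k := by
  -- Approximate `r` by the points `r + ε`, whose coordinates are positive.
  have hcont : ∀ α : Fin n → ℕ, Continuous fun ε : ℝ => ∏ i, (r i + ε) ^ α i := fun α => by
    fun_prop
  have h1 : Tendsto (fun ε : ℝ => ∏ i, (r i + ε) ^ e i) (𝓝[>] 0) (𝓝 (∏ i, r i ^ e i)) := by
    have := ((hcont e).tendsto 0).mono_left (nhdsWithin_le_nhds (s := Set.Ioi (0 : ℝ)))
    simpa using this
  have h2 : Tendsto (fun ε : ℝ => (∑ α ∈ V, ∏ i, (r i + ε) ^ α i) ^ k) (𝓝[>] 0)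
      (𝓝 ((∑ α ∈ V, ∏ i, r i ^ α i) ^ k)) := by
    have hc : Continuous fun ε : ℝ => (∑ α ∈ V, ∏ i, (r i + ε) ^ α i) ^ k :=
      (continuous_finsetSum _ fun α _ => hcont α).pow k
    have := (hc.tendsto 0).mono_left (nhdsWithin_le_nhds (s := Set.Ioi (0 : ℝ)))
    simpa using this
  have h3 : ∀ᶠ ε : ℝ in 𝓝[>] 0, ∀ i, r i + ε < 1 := by
    rw [eventually_all]
    intro i
    have : Tendsto (fun ε : ℝ => r i + ε) (𝓝[>] 0) (𝓝 (r i + 0)) :=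
      (tendsto_id.mono_left nhdsWithin_le_nhds).const_add _
    exact this.eventually_lt_const (by simpa using hr1 i)
  refine le_of_tendsto_of_tendsto h1 h2 ?_
  filter_upwards [h3, self_mem_nhdsWithin] with ε hε hε0
  exact prod_pow_le_sum_prod_pow_of_pos hV hk he
    (fun i => add_pos_of_nonneg_of_pos (hr0 i) hε0) hε

theorem rho_nonneg (h : MixedPoly n) (x : Fin n → ℂ) : 0 ≤ rho h x :=
  Finset.sum_nonneg fun _ _ => Finset.prod_nonneg fun _ _ => pow_nonneg (norm_nonneg _) _

theorem mixedSupport_nonempty {h : MixedPoly n} (hh : h ≠ 0) :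
    (mixedSupport h : Set (Fin n → ℕ)).Nonempty := by
  obtain ⟨m, hm⟩ := MvPolynomial.ne_zero_iff.1 hh
  exact ⟨_, Finset.mem_coe.2 (Finset.mem_image_of_mem _ (MvPolynomial.mem_support_iff.2 hm))⟩

theorem prod_norm_pow_le_rho_pow {h : MixedPoly n} (hh : h ≠ 0) {e : Fin n → ℕ} {k : ℕ}
    (hk : k ≠ 0) (he : LiesAbove (mixedSupport h : Set (Fin n → ℕ)) (fun i => (e i : ℝ) / k))
    {x : Fin n → ℂ} (hx : ‖x‖ < 1) : ∏ i, ‖x i‖ ^ e i ≤ rho h x ^ k := by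
  classical
  refine prod_pow_le_sum_prod_pow (A := (mixedSupport h : Set (Fin n → ℕ))) (fun w hw => ?_) hk he
    (fun i => norm_nonneg _) (fun i => (norm_le_pi_norm x i).trans_lt hx)
  obtain ⟨α, hα, hvert, hmin⟩ := exists_newtonVertex_forall_le (mixedSupport h).finite_toSet
    (mixedSupport_nonempty hh) hw
  exact ⟨α, Finset.mem_filter.2 ⟨Finset.mem_coe.1 hα, hvert⟩, hmin⟩

theorem prod_norm_pow_le_rho {h : MixedPoly n} (hh : h ≠ 0) {e : Fin n → ℕ}
    (he : LiesAbove (mixedSupport h : Set (Fin n → ℕ)) (realExp e))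
    {x : Fin n → ℂ} (hx : ‖x‖ < 1) : ∏ i, ‖x i‖ ^ e i ≤ rho h x := by
  have := prod_norm_pow_le_rho_pow hh one_ne_zero (e := e) (by simpa [realExp] using! he) hx
  rwa [pow_one] at this

theorem rho_pos {h : MixedPoly n} (hh : h ≠ 0)
    (hconv : IsConvenient (mixedSupport h : Set (Fin n → ℕ))) {x : Fin n → ℂ} (hx : ‖x‖ < 1)
    (hx0 : x ≠ 0) : 0 < rho h x := by
  obtain ⟨i, hi⟩ := Function.ne_iff.1 hx0
  obtain ⟨k, hk⟩ := hconv.exists_single_mem i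
  refine lt_of_lt_of_le ?_ (prod_norm_pow_le_rho hh (LiesAbove.of_mem hk) hx)
  refine Finset.prod_pos fun j _ => ?_
  by_cases hj : j = i
  · subst hj
    exact pow_pos (norm_pos_iff.2 hi) _
  · simp [hj]

/-! ### Mixed polynomials and their analytic families -/

/-- The exponent `ν + μ` of the mixed monomial `x^ν x̄^μ`. -/
def totalExp (m : (Fin n ⊕ Fin n) →₀ ℕ) : Fin n → ℕ := fun i => m (Sum.inl i) + m (Sum.inr i)

theorem totalExp_add (m m' : (Fin n ⊕ Fin n) →₀ ℕ) :
    totalExp (m + m') = totalExp m + totalExp m' := by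
  ext i
  simp only [totalExp, Finsupp.add_apply, Pi.add_apply]
  ring

theorem totalExp_single (k : Fin n ⊕ Fin n) :
    totalExp (Finsupp.single k 1) = Pi.single (Sum.elim id id k) 1 := by
  classical
  ext i
  rcases k with j | j <;> simp [totalExp, Finsupp.single_apply, Pi.single_apply, eq_comm]

theorem totalExp_mem_mixedSupport {p : MixedPoly n} {m : (Fin n ⊕ Fin n) →₀ ℕ}
    (hm : m ∈ p.support) : totalExp m ∈ mixedSupport p :=
  Finset.mem_image_of_mem _ hm

/-- The point `(x, x̄)` at which a mixed polynomial is evaluated. -/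
def conjPair (x : Fin n → ℂ) : Fin n ⊕ Fin n → ℂ :=
  Sum.elim x (fun i => (starRingEnd ℂ) (x i))

theorem norm_conjPair_apply (x : Fin n → ℂ) (k : Fin n ⊕ Fin n) :
    ‖conjPair x k‖ = ‖x (Sum.elim id id k)‖ := by
  rcases k with i | i <;> simp [conjPair]

theorem norm_prod_conjPair (x : Fin n → ℂ) (m : (Fin n ⊕ Fin n) →₀ ℕ) :
    ‖∏ k, conjPair x k ^ m k‖ = ∏ i, ‖x i‖ ^ totalExp m i := by
  simp only [Fintype.prod_sum_type, norm_mul, norm_prod, norm_pow, norm_conjPair_apply,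
    Sum.elim_inl, Sum.elim_inr, id, totalExp, pow_add, Finset.prod_mul_distrib]

theorem evalAt_eq_sum {p : MixedPoly n} {S : Finset ((Fin n ⊕ Fin n) →₀ ℕ)} (hS : p.support ⊆ S)
    (x : Fin n → ℂ) : p.evalAt x = ∑ m ∈ S, p.coeff m * ∏ k, conjPair x k ^ m k := by
  rw [MixedPoly.evalAt, MvPolynomial.eval_eq']
  refine Finset.sum_subset hS fun m _ hm => ?_
  rw [MvPolynomial.notMem_support_iff.1 hm, zero_mul]

theorem norm_evalAt_le {p : MixedPoly n} {S : Finset ((Fin n ⊕ Fin n) →₀ ℕ)} (hS : p.support ⊆ S)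
    {x : Fin n → ℂ} {B : ℝ} (hB : ∀ m ∈ p.support, ∏ i, ‖x i‖ ^ totalExp m i ≤ B) :
    ‖p.evalAt x‖ ≤ (∑ m ∈ S, ‖p.coeff m‖) * B := by
  rw [evalAt_eq_sum hS, Finset.sum_mul]
  refine norm_sum_le_of_le _ fun m _ => ?_
  rw [norm_mul, norm_prod_conjPair]
  by_cases hm : m ∈ p.support
  · exact mul_le_mul_of_nonneg_left (hB m hm) (norm_nonneg _)
  · rw [MvPolynomial.notMem_support_iff.1 hm]
    simp

theorem evalAt_mul (p q : MixedPoly n) (x : Fin n → ℂ) :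
    (p * q).evalAt x = p.evalAt x * q.evalAt x :=
  map_mul _ _ _

theorem evalAt_toMixed (p : MvPolynomial (Fin n) ℂ) (x : Fin n → ℂ) :
    (toMixed p).evalAt x = MvPolynomial.eval x p := by
  rw [MixedPoly.evalAt, toMixed, MvPolynomial.eval_rename]
  rfl

theorem hasDerivWithinAt_eval {σ : Type*} [Fintype σ] (p : MvPolynomial σ ℂ) {z : ℝ → σ → ℂ}
    {z' : σ → ℂ} {I : Set ℝ} {s : ℝ} (hz : HasDerivWithinAt z z' I s) :
    HasDerivWithinAt (fun s => MvPolynomial.eval (z s) p)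
      (∑ k, MvPolynomial.eval (z s) (MvPolynomial.pderiv k p) * z' k) I s := by
  classical
  rw [hasDerivWithinAt_pi] at hz
  induction p using MvPolynomial.induction_on with
  | C a => simpa using hasDerivWithinAt_const s I a
  | add p q hp hq =>
    simp only [map_add, add_mul, Finset.sum_add_distrib]
    exact hp.add hq
  | mul_X p j hp =>
    have := hp.mul (hz j)
    simp only [map_mul, MvPolynomial.eval_X]
    refine this.congr_deriv ?_
    simp only [MvPolynomial.pderiv_mul, map_add, map_mul, MvPolynomial.eval_X, add_mul,
      Finset.sum_add_distrib, Finset.sum_mul, MvPolynomial.pderiv_X]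
    congr 1
    · exact Finset.sum_congr rfl fun k _ => by ring
    · rw [Finset.sum_eq_single j]
      · simp
      · intro k _ hk
        simp [Pi.single_eq_of_ne hk.symm]
      · simp

/-- The derivative of a mixed polynomial along a segment. -/
theorem hasDerivAt_evalAt_lineMap (p : MixedPoly n) (x y : Fin n → ℂ) (s : ℝ) :
    HasDerivAt (fun s : ℝ => p.evalAt (x + s • (y - x)))
      (∑ k, MixedPoly.evalAt (MvPolynomial.pderiv k p) (x + s • (y - x)) * conjPair (y - x) k)
      s := by
  have hz : HasDerivAt (fun s : ℝ => conjPair (x + s • (y - x))) (conjPair (y - x)) s := by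
    rw [hasDerivAt_pi]
    have hbase : ∀ i, HasDerivAt (fun s : ℝ => (x + s • (y - x)) i) ((y - x) i) s := by
      intro i
      simpa using ((hasDerivAt_id s).smul_const ((y - x) i)).const_add (x i)
    rintro (i | i)
    · exact hbase i
    · exact (hbase i).star
  have := hasDerivWithinAt_eval p (hz.hasDerivWithinAt (s := Set.univ))
  rwa [hasDerivWithinAt_univ] at this

variable {Δ : Set ℂ}

theorem IsAnalyticFamily.const (p : MixedPoly n) : IsAnalyticFamily Δ (fun _ => p) :=
  ⟨⟨p.support, fun _ _ => subset_rfl⟩, fun _ => analyticOnNhd_const⟩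

theorem IsAnalyticFamily.mul {P Q : ℂ → MixedPoly n} (hP : IsAnalyticFamily Δ P)
    (hQ : IsAnalyticFamily Δ Q) : IsAnalyticFamily Δ (fun t => P t * Q t) := by
  classical
  obtain ⟨⟨S, hS⟩, hPa⟩ := hP
  obtain ⟨⟨T, hT⟩, hQa⟩ := hQ
  refine ⟨⟨Finset.image₂ (· + ·) S T, fun t ht m hm => ?_⟩, fun m => ?_⟩
  · obtain ⟨a, ha, b, hb, rfl⟩ := Finset.mem_add.1 (MvPolynomial.support_mul _ _ hm)
    exact Finset.mem_image₂_of_mem (hS t ht ha) (hT t ht hb)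
  · simp only [MvPolynomial.coeff_mul]
    exact Finset.analyticOnNhd_fun_sum _ fun x _ => (hPa _).mul (hQa _)

theorem add_single_mem_support_of_mem_support_pderiv {σ : Type*} {p : MvPolynomial σ ℂ} {k : σ}
    {m : σ →₀ ℕ} (hm : m ∈ (MvPolynomial.pderiv k p).support) :
    m + Finsupp.single k 1 ∈ p.support := by
  rw [MvPolynomial.mem_support_iff, MvPolynomial.coeff_pderiv] at hm
  exact MvPolynomial.mem_support_iff.2 (left_ne_zero_of_mul hm)

theorem IsAnalyticFamily.pderiv {P : ℂ → MixedPoly n} (hP : IsAnalyticFamily Δ P)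
    (k : Fin n ⊕ Fin n) : IsAnalyticFamily Δ (fun t => MvPolynomial.pderiv k (P t)) := by
  classical
  obtain ⟨⟨S, hS⟩, hPa⟩ := hP
  refine ⟨⟨S.image (fun m => m - Finsupp.single k 1), fun t ht m hm => ?_⟩, fun m => ?_⟩
  · exact Finset.mem_image.2 ⟨_, hS t ht (add_single_mem_support_of_mem_support_pderiv hm),
      add_tsub_cancel_right _ _⟩
  · simp only [MvPolynomial.coeff_pderiv]
    exact (hPa _).mul analyticOnNhd_const

theorem IsAnalyticFamily.finite_familySupport {P : ℂ → MixedPoly n} (hP : IsAnalyticFamily Δ P) :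
    (familySupport Δ P).Finite := by
  classical
  obtain ⟨⟨S, hS⟩, -⟩ := hP
  refine (S.image totalExp).finite_toSet.subset ?_
  rintro α ⟨t, ht, hα⟩
  obtain ⟨m, hm, rfl⟩ := Finset.mem_image.1 hα
  exact Finset.mem_coe.2 (Finset.mem_image_of_mem totalExp (hS t ht hm))

theorem IsAnalyticFamily.continuousOn_evalAt {P : ℂ → MixedPoly n} (hP : IsAnalyticFamily Δ P) :
    ContinuousOn (fun q : ℂ × (Fin n → ℂ) => (P q.1).evalAt q.2) (Δ ×ˢ Set.univ) := by
  obtain ⟨⟨S, hS⟩, hPa⟩ := hP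
  have h : ContinuousOn (fun q : ℂ × (Fin n → ℂ) =>
      ∑ m ∈ S, (P q.1).coeff m * ∏ k, conjPair q.2 k ^ m k) (Δ ×ˢ Set.univ) := by
    refine continuousOn_finsetSum _ fun m _ => ContinuousOn.mul ?_ ?_
    · exact (hPa m).continuousOn.comp continuousOn_fst fun q hq => hq.1
    · refine Continuous.continuousOn (continuous_finsetProd _ fun k _ => Continuous.pow ?_ _)
      rcases k with i | i
      · exact (continuous_apply i).comp continuous_snd
      · exact Complex.continuous_conj.comp ((continuous_apply i).comp continuous_snd)
  exact h.congr fun q hq => evalAt_eq_sum (hS q.1 hq.1) q.2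

theorem IsAnalyticFamily.exists_norm_evalAt_le {P : ℂ → MixedPoly n} (hP : IsAnalyticFamily Δ P)
    {K : Set ℂ} (hK : IsCompact K) (hKΔ : K ⊆ Δ) :
    ∃ C : ℝ, 0 ≤ C ∧ ∀ t ∈ K, ∀ (x : Fin n → ℂ) (B : ℝ), 0 ≤ B →
      (∀ m ∈ (P t).support, ∏ i, ‖x i‖ ^ totalExp m i ≤ B) → ‖(P t).evalAt x‖ ≤ C * B := by
  obtain ⟨⟨S, hS⟩, hPa⟩ := hP
  have hc : ContinuousOn (fun t => ∑ m ∈ S, ‖(P t).coeff m‖) K :=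
    continuousOn_finsetSum _ fun m _ => ((hPa m).continuousOn.mono hKΔ).norm
  obtain ⟨C, hC⟩ := hK.exists_bound_of_continuousOn hc
  refine ⟨max C 0, le_max_right _ _, fun t ht x B hB0 hB => ?_⟩
  refine (norm_evalAt_le (hS t (hKΔ ht)) hB).trans (mul_le_mul_of_nonneg_right ?_ hB0)
  exact ((le_abs_self _).trans (hC t ht)).trans (le_max_left _ _)

theorem IsAnalyticFamily.eventually_norm_evalAt_sub_le {P : ℂ → MixedPoly n}
    (hP : IsAnalyticFamily Δ P) (hΔ : IsOpen Δ) {t₀ : ℂ} (ht₀ : t₀ ∈ Δ) {ε : ℝ} (hε : 0 < ε) :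
    ∀ᶠ t in 𝓝 t₀, ∀ (x : Fin n → ℂ) (B : ℝ), 0 ≤ B →
      (∀ s ∈ Δ, ∀ m ∈ (P s).support, ∏ i, ‖x i‖ ^ totalExp m i ≤ B) →
        ‖(P t).evalAt x - (P t₀).evalAt x‖ ≤ ε * B := by
  classical
  obtain ⟨⟨S, hS⟩, hPa⟩ := hP
  have hc : Tendsto (fun t => ∑ m ∈ S, ‖(P t - P t₀).coeff m‖) (𝓝 t₀)
      (𝓝 (∑ m ∈ S, ‖(P t₀ - P t₀).coeff m‖)) := by
    refine tendsto_finsetSum _ fun m _ => Tendsto.norm ?_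
    simp only [MvPolynomial.coeff_sub]
    exact ((hPa m t₀ ht₀).continuousAt.tendsto).sub_const _
  simp only [sub_self, MvPolynomial.coeff_zero, norm_zero, Finset.sum_const_zero] at hc
  filter_upwards [hc.eventually_lt_const hε, hΔ.mem_nhds ht₀] with t ht htΔ x B hB0 hB
  have hsub := MvPolynomial.support_sub _ (P t) (P t₀)
  have heq : (P t).evalAt x - (P t₀).evalAt x = (P t - P t₀).evalAt x := (map_sub _ _ _).symm
  rw [heq]
  refine (norm_evalAt_le (hsub.trans (Finset.union_subset (hS t htΔ) (hS t₀ ht₀)))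
    fun m hm => ?_).trans (mul_le_mul_of_nonneg_right ht.le hB0)
  rcases Finset.mem_union.1 (hsub hm) with h | h
  · exact hB t htΔ m h
  · exact hB t₀ ht₀ m h

/-! ### Flows of Lipschitz vector fields depending on a parameter -/

section Flow

open Set Metric NNReal

variable {E : Type*} [NormedAddCommGroup E] [NormedSpace ℝ E]

theorem dist_le_of_approx_integralCurve {Y Z : ℝ → E → E} {K : ℝ≥0}
    (hY : ∀ τ ∈ Icc (0 : ℝ) 1, LipschitzWith K (Y τ)) {y z : ℝ → E}
    (hy : IsIntegralCurveOn y Y (Icc 0 1)) (hz : IsIntegralCurveOn z Z (Icc 0 1)) {ε : ℝ}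
    (hε : ∀ τ ∈ Icc (0 : ℝ) 1, dist (Z τ (z τ)) (Y τ (z τ)) ≤ ε) {τ : ℝ} (hτ : τ ∈ Icc (0 : ℝ) 1) :
    dist (y τ) (z τ) ≤ (dist (y 0) (z 0) + ε) * Real.exp (K + 1) := by
  have hε0 : 0 ≤ ε := dist_nonneg.trans (hε τ hτ)
  have hd : ∀ {W : ℝ → E → E} {w : ℝ → E}, IsIntegralCurveOn w W (Icc 0 1) →
      ∀ t ∈ Ico (0 : ℝ) 1, HasDerivWithinAt w (W t (w t)) (Ici t) t := fun hw t ht =>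
    (hw t (Ico_subset_Icc_self ht)).mono_of_mem_nhdsWithin (Icc_mem_nhdsGE_of_mem ht)
  have h := dist_le_of_approx_trajectories_ODE_of_mem (v := Y) (s := fun _ => univ) (K := K + 1)
    (εf := 0) (εg := ε) (a := 0) (b := 1)
    (fun t ht => ((hY t (Ico_subset_Icc_self ht)).weaken
      (le_add_of_nonneg_right zero_le_one)).lipschitzOnWith)
    hy.continuousOn (hd hy) (fun t _ => (dist_self _).le) (fun _ _ => trivial)
    hz.continuousOn (hd hz) (fun t ht => hε t (Ico_subset_Icc_self ht)) (fun _ _ => trivial)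
    le_rfl τ hτ
  refine h.trans ?_
  have hK1 : (1 : ℝ) ≤ ((K + 1 : ℝ≥0) : ℝ) := by
    rw [NNReal.coe_add, NNReal.coe_one]
    exact le_add_of_nonneg_left K.2
  rw [gronwallBound_of_K_ne_0 (by positivity), zero_add, sub_zero, add_mul]
  have hexp : Real.exp (((K + 1 : ℝ≥0) : ℝ) * τ) ≤ Real.exp (K + 1) := by
    rw [Real.exp_le_exp]
    simpa using mul_le_mul_of_nonneg_left hτ.2 (zero_le_one.trans hK1)
  exact add_le_add (mul_le_mul_of_nonneg_left hexp dist_nonneg)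
    (mul_le_mul (div_le_self hε0 hK1) (by linarith)
      (sub_nonneg.2 (Real.one_le_exp (mul_nonneg (zero_le_one.trans hK1) hτ.1))) hε0)

theorem dist_le_of_integralCurve {Y : ℝ → E → E} {K : ℝ≥0}
    (hY : ∀ τ ∈ Icc (0 : ℝ) 1, LipschitzWith K (Y τ)) {y z : ℝ → E}
    (hy : IsIntegralCurveOn y Y (Icc 0 1)) (hz : IsIntegralCurveOn z Y (Icc 0 1))
    {τ : ℝ} (hτ : τ ∈ Icc (0 : ℝ) 1) :
    dist (y τ) (z τ) ≤ dist (y 0) (z 0) * Real.exp (K + 1) := by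
  simpa using dist_le_of_approx_integralCurve hY hy hz (ε := 0) (fun _ _ => (dist_self _).le) hτ

/-- Backward Grönwall estimate, obtained by reversing time. -/
theorem dist_zero_le_of_integralCurve {Y : ℝ → E → E} {K : ℝ≥0}
    (hY : ∀ τ ∈ Icc (0 : ℝ) 1, LipschitzWith K (Y τ)) {y z : ℝ → E}
    (hy : IsIntegralCurveOn y Y (Icc 0 1)) (hz : IsIntegralCurveOn z Y (Icc 0 1)) :
    dist (y 0) (z 0) ≤ dist (y 1) (z 1) * Real.exp (K + 1) := by
  have hmaps : MapsTo (fun τ : ℝ => 1 - τ) (Icc 0 1) (Icc 0 1) := fun τ hτ =>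
    ⟨sub_nonneg.2 hτ.2, sub_le_self 1 hτ.1⟩
  have hrev : ∀ {w : ℝ → E}, IsIntegralCurveOn w Y (Icc 0 1) →
      IsIntegralCurveOn (fun τ => w (1 - τ)) (fun τ x => -Y (1 - τ) x) (Icc 0 1) := by
    intro w hw τ hτ
    have h1 : HasDerivWithinAt (fun τ : ℝ => 1 - τ) (-1) (Icc 0 1) τ :=
      ((hasDerivAt_id τ).const_sub 1).hasDerivWithinAt
    simpa using! (hw (1 - τ) (hmaps hτ)).scomp τ h1 hmaps
  have := dist_le_of_integralCurve (Y := fun τ x => -Y (1 - τ) x) (K := K)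
    (fun τ hτ => (hY _ (hmaps hτ)).neg) (hrev hy) (hrev hz) (right_mem_Icc.2 zero_le_one)
  simpa using this

theorem exists_integralCurveOn [CompleteSpace E] {Y : ℝ → E → E} {K M : ℝ≥0}
    (hY : ∀ τ ∈ Icc (0 : ℝ) 1, LipschitzWith K (Y τ))
    (hYc : ∀ x, ContinuousOn (fun τ => Y τ x) (Icc 0 1))
    (hM : ∀ τ ∈ Icc (0 : ℝ) 1, ∀ x, ‖Y τ x‖ ≤ M) {τ₀ : ℝ} (hτ₀ : τ₀ ∈ Icc (0 : ℝ) 1) (x : E) :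
    ∃ y : ℝ → E, y τ₀ = x ∧ IsIntegralCurveOn y Y (Icc 0 1) := by
  have hPL : IsPicardLindelof Y (⟨τ₀, hτ₀⟩ : Icc (0 : ℝ) 1) x M 0 M K :=
    { lipschitzOnWith := fun τ hτ => (hY τ hτ).lipschitzOnWith
      continuousOn := fun x _ => hYc x
      norm_le := fun τ hτ x _ => hM τ hτ x
      mul_max_le := by
        have : max (1 - τ₀) (τ₀ - 0) ≤ 1 :=
          max_le (sub_le_self 1 hτ₀.1) (by simpa using hτ₀.2)
        simpa using mul_le_mul_of_nonneg_left this M.2 }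
  exact hPL.exists_eq_forall_mem_Icc_hasDerivWithinAt₀

/-- The radial retraction of a normed space onto the closed ball of radius `r` around `0`. -/
def radialRetraction (r : ℝ) (x : E) : E := (r / max r ‖x‖) • x

theorem radialRetraction_of_mem {r : ℝ} (hr : 0 < r) {x : E} (hx : x ∈ closedBall (0 : E) r) :
    radialRetraction r x = x := by
  rw [radialRetraction, max_eq_left (mem_closedBall_zero_iff.1 hx), div_self hr.ne', one_smul]

theorem radialRetraction_mem {r : ℝ} (hr : 0 < r) (x : E) :
    radialRetraction r x ∈ closedBall (0 : E) r := by
  have hpos : 0 < max r ‖x‖ := lt_max_of_lt_left hr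
  rw [mem_closedBall_zero_iff, radialRetraction, norm_smul, Real.norm_of_nonneg (by positivity),
    div_mul_eq_mul_div, div_le_iff₀ hpos]
  exact mul_le_mul_of_nonneg_left (le_max_right _ _) hr.le

theorem lipschitzWith_radialRetraction {r : ℝ} (hr : 0 < r) :
    LipschitzWith 2 (radialRetraction r : E → E) := by
  refine LipschitzWith.of_dist_le_mul fun x y => ?_
  rw [dist_eq_norm, dist_eq_norm]
  set a := max r ‖x‖ with ha
  set b := max r ‖y‖ with hb
  have ha0 : 0 < a := lt_max_of_lt_left hr
  have hb0 : 0 < b := lt_max_of_lt_left hr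
  have hab : |b - a| ≤ ‖x - y‖ := by
    refine (abs_max_sub_max_le_max r ‖y‖ r ‖x‖).trans ?_
    rw [sub_self, abs_zero, max_eq_right (abs_nonneg _), abs_sub_comm]
    exact abs_norm_sub_norm_le x y
  have hsplit : radialRetraction r x - radialRetraction r y =
      (r / a) • (x - y) + ((r / a) * ((b - a) / b)) • y := by
    have : r / b = r / a - (r / a) * ((b - a) / b) := by field_simp; ring
    rw [radialRetraction, radialRetraction, ← ha, ← hb, this, sub_smul, smul_sub]
    abel
  have hra : r / a ≤ 1 := (div_le_one ha0).2 (le_max_left _ _)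
  have hyb : ‖y‖ / b ≤ 1 := (div_le_one hb0).2 (le_max_right _ _)
  have hra0 : 0 ≤ r / a := by positivity
  rw [hsplit]
  calc ‖(r / a) • (x - y) + ((r / a) * ((b - a) / b)) • y‖
      ≤ ‖(r / a) • (x - y)‖ + ‖((r / a) * ((b - a) / b)) • y‖ := norm_add_le _ _
    _ = (r / a) * ‖x - y‖ + (r / a) * |b - a| * (‖y‖ / b) := by
        rw [norm_smul, norm_smul, norm_mul, norm_div (b - a) b, Real.norm_of_nonneg hra0,
          Real.norm_of_nonneg hb0.le, Real.norm_eq_abs]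
        ring
    _ ≤ 1 * ‖x - y‖ + 1 * ‖x - y‖ * 1 := by gcongr
    _ = (2 : ℝ≥0) * ‖x - y‖ := by rw [NNReal.coe_ofNat]; ring

/-- The time-one map of a parametrised vector field is jointly continuous in the parameter and the
initial point: along a fixed trajectory the field changes little, uniformly in time. -/
theorem continuousOn_timeOne {T : Type*} [TopologicalSpace T] {V : Set T} {Y : T → ℝ → E → E}
    {K : ℝ≥0} (hY : ∀ s ∈ V, ∀ τ ∈ Icc (0 : ℝ) 1, LipschitzWith K (Y s τ))
    (hYc : ContinuousOn (fun p : (T × ℝ) × E => Y p.1.1 p.1.2 p.2) ((V ×ˢ Icc 0 1) ×ˢ univ))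
    {γ : T → E → ℝ → E} (hγ0 : ∀ s ∈ V, ∀ x, γ s x 0 = x)
    (hγ : ∀ s ∈ V, ∀ x, IsIntegralCurveOn (γ s x) (Y s) (Icc 0 1)) :
    ContinuousOn (fun q : T × E => γ q.1 q.2 1) (V ×ˢ univ) := by
  rintro ⟨s₀, x₀⟩ ⟨hs₀, -⟩
  have hs₀ : s₀ ∈ V := hs₀
  rw [ContinuousWithinAt, tendsto_iff_dist_tendsto_zero]
  refine (nhds_basis_abs_sub_lt (0 : ℝ)).tendsto_right_iff.2 fun ε hε => ?_
  set C := Real.exp (K + 1) with hC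
  have hC0 : 0 < C := Real.exp_pos _
  set η := ε / (2 * C) / 2 with hη
  have hη0 : 0 < η := by positivity
  have hunif : ∀ᶠ s in 𝓝 s₀, ∀ τ ∈ Icc (0 : ℝ) 1, s ∈ V → τ ∈ Icc (0 : ℝ) 1 →
      dist (Y s₀ τ (γ s₀ x₀ τ)) (Y s τ (γ s₀ x₀ τ)) < η := by
    refine isCompact_Icc.eventually_forall_of_forall_eventually fun τ hτ => ?_
    have hcurve : ContinuousOn (fun p : T × ℝ => ((p : T × ℝ), γ s₀ x₀ p.2)) (V ×ˢ Icc 0 1) :=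
      continuousOn_id.prodMk ((hγ s₀ hs₀ x₀).continuousOn.comp continuousOn_snd fun p hp => hp.2)
    have h1 : ContinuousOn (fun p : T × ℝ => Y p.1 p.2 (γ s₀ x₀ p.2)) (V ×ˢ Icc 0 1) :=
      hYc.comp hcurve fun p hp => ⟨hp, trivial⟩
    have h2 : ContinuousOn (fun p : T × ℝ => Y s₀ p.2 (γ s₀ x₀ p.2)) (V ×ˢ Icc 0 1) :=
      h1.comp (continuousOn_const.prodMk continuousOn_snd) fun p hp => ⟨hs₀, hp.2⟩
    have h3 := continuous_dist.comp_continuousOn (h2.prodMk h1)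
    have h4 := (h3 (s₀, τ) ⟨hs₀, hτ⟩).eventually_lt_const (u := η) (by simpa using hη0)
    filter_upwards [eventually_nhdsWithin_iff.1 h4] with p hp hpV hpτ
    exact hp ⟨hpV, hpτ⟩
  have h1 : ∀ᶠ q : T × E in 𝓝[V ×ˢ univ] (s₀, x₀), ∀ τ ∈ Icc (0 : ℝ) 1, q.1 ∈ V →
      τ ∈ Icc (0 : ℝ) 1 → dist (Y s₀ τ (γ s₀ x₀ τ)) (Y q.1 τ (γ s₀ x₀ τ)) < η :=
    ((continuous_fst.tendsto (s₀, x₀)).eventually hunif).filter_mono nhdsWithin_le_nhds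
  have h2 : ∀ᶠ q : T × E in 𝓝[V ×ˢ univ] (s₀, x₀), dist q.2 x₀ < η :=
    ((continuous_snd.tendsto (s₀, x₀)).eventually (ball_mem_nhds x₀ hη0)).filter_mono
      nhdsWithin_le_nhds
  filter_upwards [h1, h2, self_mem_nhdsWithin] with q hq1 hq2 hqV
  have hqV : q.1 ∈ V := hqV.1
  have hle := dist_le_of_approx_integralCurve (hY q.1 hqV) (hγ q.1 hqV q.2) (hγ s₀ hs₀ x₀)
    (ε := η) (fun τ hτ => (hq1 τ hτ hqV hτ).le) (right_mem_Icc.2 zero_le_one)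
  rw [hγ0 _ hqV, hγ0 _ hs₀] at hle
  rw [sub_zero, abs_of_nonneg dist_nonneg]
  refine hle.trans_lt ?_
  calc (dist q.2 x₀ + η) * C < (η + η) * C := by gcongr
    _ = ε / 2 := by rw [hη]; field_simp; ring
    _ < ε := half_lt_self hε

end Flow

open Set Metric NNReal in
/-- A vector field on a ball that vanishes at the origin and is Lipschitz in `x` integrates, in the
direction `t - t₀`, to a continuous family of bi-Lipschitz germs. The field is first extended to the
whole space by a retraction; trajectories starting close to the origin do not see the extension. -/
theorem exists_isBiLipschitzGerm_family {t₀ : ℂ} {δ r : ℝ} (hδ1 : δ ≤ 1) (hr : 0 < r)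
    {X : ℂ → (Fin n → ℂ) → (Fin n → ℂ)} {L : ℝ≥0}
    (hXc : ContinuousOn (fun q : ℂ × (Fin n → ℂ) => X q.1 q.2) (ball t₀ δ ×ˢ closedBall 0 r))
    (hX : ∀ t ∈ ball t₀ δ, LipschitzOnWith L (X t) (closedBall 0 r))
    (hX0 : ∀ t ∈ ball t₀ δ, X t 0 = 0) :
    ∃ W : Set (Fin n → ℂ), IsOpen W ∧ 0 ∈ W ∧ ∃ φ : ℂ → (Fin n → ℂ) → (Fin n → ℂ),
      ContinuousOn (fun q : ℂ × (Fin n → ℂ) => φ q.1 q.2) (ball t₀ δ ×ˢ W) ∧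
      (∀ t ∈ ball t₀ δ, IsBiLipschitzGerm W (φ t)) ∧
      ∀ t ∈ ball t₀ δ, ∀ x ∈ W, ∃ y : ℝ → Fin n → ℂ, y 0 = x ∧ y 1 = φ t x ∧
        (∀ τ ∈ Icc (0 : ℝ) 1, y τ ∈ closedBall 0 r) ∧
        IsIntegralCurveOn y (fun τ x => (t - t₀) • X (t₀ + (τ : ℂ) * (t - t₀)) x) (Icc 0 1) := by
  set V := ball t₀ δ with hV
  set Y : ℂ → ℝ → (Fin n → ℂ) → (Fin n → ℂ) := fun t τ x =>
    (t - t₀) • X (t₀ + (τ : ℂ) * (t - t₀)) (radialRetraction r x) with hYdef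
  have hmem : ∀ t ∈ V, ∀ τ ∈ Icc (0 : ℝ) 1, t₀ + (τ : ℂ) * (t - t₀) ∈ V := by
    intro t ht τ hτ
    rw [hV, mem_ball, dist_eq_norm, add_sub_cancel_left, norm_mul, Complex.norm_real,
      Real.norm_of_nonneg hτ.1]
    rw [hV, mem_ball, dist_eq_norm] at ht
    exact (mul_le_of_le_one_left (norm_nonneg _) hτ.2).trans_lt ht
  have hnorm : ∀ t ∈ V, ‖t - t₀‖ ≤ 1 := fun t ht => by
    rw [hV, mem_ball, dist_eq_norm] at ht
    exact ht.le.trans hδ1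
  have hret := lipschitzWith_radialRetraction (E := Fin n → ℂ) hr
  have hYlip : ∀ t ∈ V, ∀ τ ∈ Icc (0 : ℝ) 1, LipschitzWith (L * 2) (Y t τ) := by
    intro t ht τ hτ
    refine LipschitzWith.of_dist_le_mul fun x y => ?_
    rw [hYdef, dist_smul₀]
    have h1 := (hX _ (hmem t ht τ hτ)).dist_le_mul _ (radialRetraction_mem hr x)
      _ (radialRetraction_mem hr y)
    have h2 := hret.dist_le_mul x y
    refine (mul_le_of_le_one_left dist_nonneg (hnorm t ht)).trans (h1.trans ?_)
    rw [NNReal.coe_mul, mul_assoc]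
    exact mul_le_mul_of_nonneg_left h2 L.2
  have hYbd : ∀ t ∈ V, ∀ τ ∈ Icc (0 : ℝ) 1, ∀ x, ‖Y t τ x‖ ≤ (L * r.toNNReal : ℝ≥0) := by
    intro t ht τ hτ x
    have ht' := hmem t ht τ hτ
    have h1 := (hX _ ht').dist_le_mul _ (radialRetraction_mem hr x) 0
      (mem_closedBall_self hr.le)
    rw [hX0 _ ht', dist_zero_right, dist_zero_right] at h1
    rw [hYdef, norm_smul]
    refine (mul_le_of_le_one_left (norm_nonneg _) (hnorm t ht)).trans (h1.trans ?_)
    rw [NNReal.coe_mul, Real.coe_toNNReal r hr.le]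
    exact mul_le_mul_of_nonneg_left (mem_closedBall_zero_iff.1 (radialRetraction_mem hr x)) L.2
  have hYc : ContinuousOn (fun p : (ℂ × ℝ) × (Fin n → ℂ) => Y p.1.1 p.1.2 p.2)
      ((V ×ˢ Icc 0 1) ×ˢ univ) := by
    refine ContinuousOn.smul (f := fun p : (ℂ × ℝ) × (Fin n → ℂ) => p.1.1 - t₀) (by fun_prop) ?_
    refine hXc.comp (f := fun p : (ℂ × ℝ) × (Fin n → ℂ) =>
      (t₀ + (p.1.2 : ℂ) * (p.1.1 - t₀), radialRetraction r p.2)) ?_ ?_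
    · exact (Continuous.prodMk (by fun_prop) (hret.continuous.comp continuous_snd)).continuousOn
    · rintro p ⟨⟨hp1, hp2⟩, -⟩
      exact ⟨hmem _ hp1 _ hp2, radialRetraction_mem hr _⟩
  have hYc' : ∀ t ∈ V, ∀ x, ContinuousOn (fun τ => Y t τ x) (Icc 0 1) := by
    intro t ht x
    exact hYc.comp (f := fun τ : ℝ => ((t, τ), x)) (by fun_prop) fun τ hτ => ⟨⟨ht, hτ⟩, trivial⟩
  have hex : ∀ t x, ∃ y : ℝ → Fin n → ℂ, t ∈ V → y 0 = x ∧ IsIntegralCurveOn y (Y t) (Icc 0 1) := by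
    intro t x
    by_cases ht : t ∈ V
    · obtain ⟨y, hy⟩ := exists_integralCurveOn (hYlip t ht) (hYc' t ht) (hYbd t ht)
        (left_mem_Icc.2 zero_le_one) x
      exact ⟨y, fun _ => hy⟩
    · exact ⟨fun _ => 0, fun h => absurd h ht⟩
  choose γ hγ using hex
  have hzero : ∀ t ∈ V, IsIntegralCurveOn (fun _ => (0 : Fin n → ℂ)) (Y t) (Icc 0 1) := by
    intro t ht τ hτ
    have : Y t τ 0 = 0 := by
      rw [hYdef]
      simp only [radialRetraction_of_mem hr (mem_closedBall_self hr.le), hX0 _ (hmem t ht τ hτ),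
        smul_zero]
    show HasDerivWithinAt (fun _ => (0 : Fin n → ℂ)) (Y t τ 0) (Icc 0 1) τ
    rw [this]
    exact hasDerivWithinAt_const _ _ _
  set C := Real.exp ((L * 2 : ℝ≥0) + 1) with hC
  have hC0 : 0 < C := Real.exp_pos _
  have hfwd : ∀ t ∈ V, ∀ x y, ‖γ t x 1 - γ t y 1‖ ≤ C * ‖x - y‖ := by
    intro t ht x y
    have := dist_le_of_integralCurve (hYlip t ht) (hγ t x ht).2 (hγ t y ht).2
      (right_mem_Icc.2 zero_le_one)
    rwa [(hγ t x ht).1, (hγ t y ht).1, dist_eq_norm, dist_eq_norm, mul_comm] at this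
  have hbwd : ∀ t ∈ V, ∀ x y, ‖x - y‖ ≤ C * ‖γ t x 1 - γ t y 1‖ := by
    intro t ht x y
    have := dist_zero_le_of_integralCurve (hYlip t ht) (hγ t x ht).2 (hγ t y ht).2
    rwa [(hγ t x ht).1, (hγ t y ht).1, dist_eq_norm, dist_eq_norm, mul_comm] at this
  have hball : ∀ t ∈ V, ∀ x ∈ ball (0 : Fin n → ℂ) (r / C), ∀ τ ∈ Icc (0 : ℝ) 1,
      γ t x τ ∈ closedBall 0 r := by
    intro t ht x hx τ hτ
    have := dist_le_of_integralCurve (hYlip t ht) (hγ t x ht).2 (hzero t ht) hτ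
    rw [(hγ t x ht).1] at this
    rw [mem_closedBall]
    refine this.trans ?_
    rw [← le_div_iff₀ hC0]
    exact (mem_ball.1 hx).le
  refine ⟨ball 0 (r / C), isOpen_ball, mem_ball_self (by positivity), fun t x => γ t x 1,
    (continuousOn_timeOne hYlip hYc (fun t ht x => (hγ t x ht).1) fun t ht x =>
      (hγ t x ht).2).mono (prod_mono_right (subset_univ _)), fun t ht => ⟨?_, ?_, C, hC0, ?_⟩, ?_⟩
  · have := dist_le_of_integralCurve (hYlip t ht) (hγ t 0 ht).2 (hzero t ht)
      (right_mem_Icc.2 zero_le_one)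
    rw [(hγ t 0 ht).1, dist_self, zero_mul] at this
    exact dist_le_zero.1 this
  · -- The time-one map has a Lipschitz inverse, so it is open.
    have hsurj : ∀ z, ∃ x, γ t x 1 = z := by
      intro z
      obtain ⟨y, hy1, hy⟩ := exists_integralCurveOn (hYlip t ht) (hYc' t ht) (hYbd t ht)
        (right_mem_Icc.2 zero_le_one) z
      refine ⟨y 0, ?_⟩
      have := dist_le_of_integralCurve (hYlip t ht) (hγ t (y 0) ht).2 hy
        (right_mem_Icc.2 zero_le_one)
      rw [(hγ t (y 0) ht).1, dist_self, zero_mul, hy1] at this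
      exact dist_le_zero.1 this
    choose ψ hψ using hsurj
    have hψφ : ∀ x, ψ (γ t x 1) = x := fun x => by
      have := hbwd t ht (ψ (γ t x 1)) x
      rw [hψ, sub_self, norm_zero, mul_zero] at this
      exact sub_eq_zero.1 (norm_le_zero_iff.1 this)
    have hψc : Continuous ψ := by
      refine (LipschitzWith.of_dist_le_mul (K := ⟨C, hC0.le⟩) fun x y => ?_).continuous
      rw [dist_eq_norm, dist_eq_norm]
      have := hbwd t ht (ψ x) (ψ y)
      rwa [hψ, hψ] at this
    have himg : (fun x => γ t x 1) '' ball 0 (r / C) = ψ ⁻¹' ball 0 (r / C) := by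
      ext z
      constructor
      · rintro ⟨x, hx, rfl⟩
        simpa [hψφ] using hx
      · exact fun hz => ⟨ψ z, hz, hψ z⟩
    rw [himg]
    exact isOpen_ball.preimage hψc
  · exact fun x _ y _ => ⟨hfwd t ht x y, hbwd t ht x y⟩
  · intro t ht x hx
    refine ⟨γ t x, (hγ t x ht).1, rfl, hball t ht x hx, fun τ hτ => ?_⟩
    have := (hγ t x ht).2 τ hτ
    simp only [hYdef] at this
    rwa [radialRetraction_of_mem hr (hball t ht x hx τ hτ)] at this

/-! ### Filtration conditions -/

/-- On every compact facet of `A` some associated weight gives `e` a degree that exceeds the minimum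
over `A` by at least the largest coordinate of the weight. -/
def IsSubordinate (A : Set (Fin n → ℕ)) (e : Fin n → ℕ) : Prop :=
  ∀ σ, IsCompactFacet A σ → ∃ w : Fin n → ℚ, IsWeight σ w ∧
    ∃ β ∈ A, (∀ γ ∈ A, (fun i => (w i : ℝ)) ⬝ᵥ realExp β ≤ (fun i => (w i : ℝ)) ⬝ᵥ realExp γ) ∧
      ∀ j, (fun i => (w i : ℝ)) ⬝ᵥ realExp β + w j ≤ (fun i => (w i : ℝ)) ⬝ᵥ realExp e

theorem IsSubordinate.of_fil {A B G : Set (Fin n → ℕ)} (hA : A.Finite) (hne : A.Nonempty)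
    (h : ∀ σ, IsCompactFacet A σ → ∃ w, IsWeight σ w ∧
      0 ≤ fil w G + fil w B - fil w A - maxWeight w) {a b : Fin n → ℕ} (ha : a ∈ G) (hb : b ∈ B) :
    IsSubordinate A (a + b) := by
  intro σ hσ
  obtain ⟨w, hw, h0⟩ := h σ hσ
  set v : Fin n → ℝ := fun i => (w i : ℝ) with hv
  obtain ⟨β, hβ, hmin⟩ := Set.exists_min_image A (fun γ => v ⬝ᵥ realExp γ) hA hne
  refine ⟨w, hw, β, hβ, hmin, fun j => ?_⟩
  have hG : fil w G ≤ ((v ⬝ᵥ realExp a : ℝ) : EReal) := iInf₂_le a ha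
  have hB : fil w B ≤ ((v ⬝ᵥ realExp b : ℝ) : EReal) := iInf₂_le b hb
  have hAβ : ((v ⬝ᵥ realExp β : ℝ) : EReal) ≤ fil w A :=
    le_iInf₂ fun γ hγ => EReal.coe_le_coe_iff.2 (hmin γ hγ)
  have hj : ((w j : ℝ) : EReal) ≤ maxWeight w := le_iSup (fun i => ((w i : ℝ) : EReal)) j
  have h1 := h0.trans (EReal.sub_le_sub (EReal.sub_le_sub (add_le_add hG hB) hAβ) hj)
  have h2 : 0 ≤ v ⬝ᵥ realExp a + v ⬝ᵥ realExp b - v ⬝ᵥ realExp β - w j := by exact_mod_cast h1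
  have h3 : realExp (a + b) = realExp a + realExp b := by
    ext i; simp [realExp]
  rw [h3, dotProduct_add]
  linarith

theorem realExp_sub_single {e : Fin n → ℕ} {j : Fin n} (hj : e j ≠ 0) :
    realExp (e - Pi.single j 1) = realExp e - Pi.single j 1 := by
  ext i
  by_cases hi : i = j
  · subst hi
    simp [realExp, Nat.cast_sub (Nat.one_le_iff_ne_zero.2 hj)]
  · simp [realExp, hi]

/-- First-order derivatives of a subordinate monomial are controlled by `A`. -/
theorem IsSubordinate.liesAbove_sub_single {A : Set (Fin n → ℕ)} (hA : A.Finite)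
    (hne : A.Nonempty) (haxis : ∀ i, ∃ k : ℕ, Pi.single i k ∈ A) {e : Fin n → ℕ}
    (he : IsSubordinate A e) {j : Fin n} (hj : e j ≠ 0) :
    LiesAbove A (realExp (e - Pi.single j 1)) := by
  refine LiesAbove.of_facets hA hne haxis (realExp_nonneg _) fun σ hσ => ?_
  obtain ⟨w, hw, β, hβ, -, hle⟩ := he σ hσ
  refine ⟨w, hw, β, hβ, ?_⟩
  rw [realExp_sub_single hj, dotProduct_sub, dotProduct_single, mul_one]
  linarith [hle j]

/-- The product of a subordinate monomial with a first-order derivative of a monomial from `A` is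
controlled by the square of `A`. -/
theorem IsSubordinate.liesAbove_half {A : Set (Fin n → ℕ)} (hA : A.Finite)
    (hne : A.Nonempty) (haxis : ∀ i, ∃ k : ℕ, Pi.single i k ∈ A) {e : Fin n → ℕ}
    (he : IsSubordinate A e) {η : Fin n → ℕ} (hη : η ∈ A) {j : Fin n} (hj : η j ≠ 0) :
    LiesAbove A (fun i => ((e + (η - Pi.single j 1) : Fin n → ℕ) i : ℝ) / (2 : ℕ)) := by
  refine LiesAbove.of_facets hA hne haxis (fun i => by positivity) fun σ hσ => ?_
  obtain ⟨w, hw, β, hβ, hmin, hle⟩ := he σ hσ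
  refine ⟨w, hw, β, hβ, ?_⟩
  have h1 : (fun i => ((e + (η - Pi.single j 1) : Fin n → ℕ) i : ℝ) / (2 : ℕ)) =
      (1 / 2 : ℝ) • (realExp e + (realExp η - Pi.single j 1)) := by
    rw [← realExp_sub_single hj]
    ext i
    simp only [Pi.add_apply, Pi.smul_apply, realExp, smul_eq_mul, Nat.cast_add, Nat.cast_ofNat]
    ring
  rw [h1, dotProduct_smul, dotProduct_add, dotProduct_sub, dotProduct_single, mul_one, smul_eq_mul]
  linarith [hle j, hmin η hη]

/-! ### Lipschitz estimates for quotients of mixed polynomials -/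

theorem prod_norm_pow_eq_mul {x : Fin n → ℂ} {e : Fin n → ℕ} {j : Fin n} (hj : e j ≠ 0) :
    ∏ i, ‖x i‖ ^ e i = ‖x j‖ * ∏ i, ‖x i‖ ^ (e - Pi.single j 1 : Fin n → ℕ) i := by
  have h : e = Pi.single j 1 + (e - Pi.single j 1 : Fin n → ℕ) := by
    ext i
    by_cases hi : i = j
    · subst hi
      simp only [Pi.add_apply, Pi.sub_apply, Pi.single_eq_same]
      omega
    · simp [hi]
  conv_lhs => rw [h]
  simp only [Pi.add_apply, pow_add, Finset.prod_mul_distrib]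
  congr 1
  rw [Finset.prod_eq_single j]
  · simp
  · intro i _ hi
    simp [hi]
  · simp

theorem norm_evalAt_div_le {p q : MixedPoly n} {ρ : ℝ} {x : Fin n → ℂ} {c C : ℝ} (hc : 0 < c)
    (hρ : x ≠ 0 → 0 < ρ) (hq : c * ρ ≤ ‖q.evalAt x‖) (hp : ‖p.evalAt x‖ ≤ C * (‖x‖ * ρ)) :
    ‖p.evalAt x / q.evalAt x‖ ≤ C / c * ‖x‖ := by
  by_cases hx : x = 0
  · subst hx
    have : p.evalAt 0 = 0 := by simpa using hp
    simp [this]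
  · have hcρ := mul_pos hc (hρ hx)
    rw [norm_div, div_le_iff₀ (hcρ.trans_le hq)]
    have hC : 0 ≤ C := nonneg_of_mul_nonneg_left ((norm_nonneg _).trans hp)
      (mul_pos (norm_pos_iff.2 hx) (hρ hx))
    calc ‖p.evalAt x‖ ≤ C * (‖x‖ * ρ) := hp
      _ = C / c * ‖x‖ * (c * ρ) := by field_simp
      _ ≤ _ := mul_le_mul_of_nonneg_left hq (by positivity)

/-- A quotient `p / q` of mixed polynomials with `|q| ≥ c ρ`, `|∂p| ≤ C ρ` and `|p ∂q| ≤ C ρ²` has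
bounded derivative away from the origin. Segments through the origin are treated with the bound
`|p / q| ≤ (C / c) |x|`. -/
theorem norm_evalAt_div_sub_le {p q : MixedPoly n} {ρ : (Fin n → ℂ) → ℝ} {r c C : ℝ}
    (hc : 0 < c) (hC : 0 ≤ C) (hρ : ∀ x ∈ Metric.closedBall (0 : Fin n → ℂ) r, x ≠ 0 → 0 < ρ x)
    (hq : ∀ x ∈ Metric.closedBall (0 : Fin n → ℂ) r, c * ρ x ≤ ‖q.evalAt x‖)
    (hp : ∀ x ∈ Metric.closedBall (0 : Fin n → ℂ) r, ‖p.evalAt x‖ ≤ C * (‖x‖ * ρ x))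
    (hdp : ∀ k, ∀ x ∈ Metric.closedBall (0 : Fin n → ℂ) r,
      ‖MixedPoly.evalAt (MvPolynomial.pderiv k p) x‖ ≤ C * ρ x)
    (hdq : ∀ k, ∀ x ∈ Metric.closedBall (0 : Fin n → ℂ) r,
      ‖p.evalAt x * MixedPoly.evalAt (MvPolynomial.pderiv k q) x‖ ≤ C * ρ x ^ 2)
    {x y : Fin n → ℂ} (hx : x ∈ Metric.closedBall (0 : Fin n → ℂ) r)
    (hy : y ∈ Metric.closedBall (0 : Fin n → ℂ) r) :
    ‖p.evalAt y / q.evalAt y - p.evalAt x / q.evalAt x‖ ≤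
      (C / c + Fintype.card (Fin n ⊕ Fin n) * (C / c + C / c ^ 2)) * ‖y - x‖ := by
  set N : ℝ := ((Fintype.card (Fin n ⊕ Fin n) : ℕ) : ℝ) with hN
  have hN0 : 0 ≤ N := Nat.cast_nonneg _
  set u : ℝ → Fin n → ℂ := fun s => x + s • (y - x) with hu
  have hu1 : u 1 = y := by simp [hu]
  have hu0 : u 0 = x := by simp [hu]
  have hur : ∀ s ∈ Set.Icc (0 : ℝ) 1, u s ∈ Metric.closedBall (0 : Fin n → ℂ) r := fun s hs =>
    (convex_closedBall (0 : Fin n → ℂ) r).add_smul_sub_mem hx hy hs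
  by_cases hseg : ∃ s ∈ Set.Icc (0 : ℝ) 1, u s = 0
  · obtain ⟨s, hs, hs0⟩ := hseg
    have h1 : ‖x‖ = s * ‖y - x‖ := by
      conv_lhs => rw [eq_neg_of_add_eq_zero_left hs0]
      rw [norm_neg, norm_smul, Real.norm_of_nonneg hs.1]
    have h2 : ‖y‖ = (1 - s) * ‖y - x‖ := by
      have : y = (1 - s) • (y - x) := by
        rw [sub_smul, one_smul, ← sub_eq_zero]
        have : x + s • (y - x) = 0 := hs0
        rw [← this]
        abel
      conv_lhs => rw [this]
      rw [norm_smul, Real.norm_of_nonneg (sub_nonneg.2 hs.2)]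
    calc ‖p.evalAt y / q.evalAt y - p.evalAt x / q.evalAt x‖
        ≤ ‖p.evalAt y / q.evalAt y‖ + ‖p.evalAt x / q.evalAt x‖ := norm_sub_le _ _
      _ ≤ C / c * ‖y‖ + C / c * ‖x‖ := add_le_add
          (norm_evalAt_div_le hc (hρ y hy) (hq y hy) (hp y hy))
          (norm_evalAt_div_le hc (hρ x hx) (hq x hx) (hp x hx))
      _ = (C / c) * ‖y - x‖ := by rw [h1, h2]; ring
      _ ≤ _ := mul_le_mul_of_nonneg_right (le_add_of_nonneg_right (by positivity)) (norm_nonneg _)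
  · push Not at hseg
    have hconj : ∀ k, ‖conjPair (y - x) k‖ ≤ ‖y - x‖ := fun k => by
      rw [norm_conjPair_apply]
      exact norm_le_pi_norm _ _
    have hsum : ∀ (a : Fin n ⊕ Fin n → ℂ) (b : ℝ), (∀ k, ‖a k‖ ≤ b) →
        ‖∑ k, a k * conjPair (y - x) k‖ ≤ N * (b * ‖y - x‖) := by
      intro a b hab
      refine (norm_sum_le_of_le _ fun k _ => ?_).trans (b := ∑ _k : Fin n ⊕ Fin n, b * ‖y - x‖) ?_
      · rw [norm_mul]
        exact mul_le_mul (hab k) (hconj k) (norm_nonneg _) ((norm_nonneg _).trans (hab k))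
      · rw [Finset.sum_const, nsmul_eq_mul, Finset.card_univ]
    have hqpos : ∀ s ∈ Set.Icc (0 : ℝ) 1, 0 < ‖q.evalAt (u s)‖ := fun s hs =>
      (mul_pos hc (hρ _ (hur s hs) (hseg s hs))).trans_le (hq _ (hur s hs))
    have hderiv : ∀ s ∈ Set.Icc (0 : ℝ) 1,
        HasDerivWithinAt (fun s => p.evalAt (u s) / q.evalAt (u s))
          (((∑ k, MixedPoly.evalAt (MvPolynomial.pderiv k p) (u s) * conjPair (y - x) k) *
              q.evalAt (u s) - p.evalAt (u s) *
            ∑ k, MixedPoly.evalAt (MvPolynomial.pderiv k q) (u s) * conjPair (y - x) k) /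
              q.evalAt (u s) ^ 2) (Set.Icc 0 1) s := fun s hs =>
      ((hasDerivAt_evalAt_lineMap p x y s).div (hasDerivAt_evalAt_lineMap q x y s)
        (norm_pos_iff.1 (hqpos s hs))).hasDerivWithinAt
    have hbound : ∀ s ∈ Set.Ico (0 : ℝ) 1,
        ‖((∑ k, MixedPoly.evalAt (MvPolynomial.pderiv k p) (u s) * conjPair (y - x) k) *
              q.evalAt (u s) - p.evalAt (u s) *
            ∑ k, MixedPoly.evalAt (MvPolynomial.pderiv k q) (u s) * conjPair (y - x) k) /
              q.evalAt (u s) ^ 2‖ ≤ N * (C / c + C / c ^ 2) * ‖y - x‖ := by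
      intro s hs
      have hs := Set.Ico_subset_Icc_self hs
      have hz := hur s hs
      set z := u s
      have hρz := hρ z hz (hseg s hs)
      have hqz := hqpos s hs
      have h1 := hsum _ _ fun k => hdp k z hz
      have h2 := hsum (fun k => p.evalAt z * MixedPoly.evalAt (MvPolynomial.pderiv k q) z) _
        fun k => hdq k z hz
      have h3 : p.evalAt z *
          ∑ k, MixedPoly.evalAt (MvPolynomial.pderiv k q) z * conjPair (y - x) k =
          ∑ k, p.evalAt z * MixedPoly.evalAt (MvPolynomial.pderiv k q) z * conjPair (y - x) k := by
        rw [Finset.mul_sum]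
        exact Finset.sum_congr rfl fun k _ => by ring
      rw [h3, norm_div, norm_pow, div_le_iff₀ (pow_pos hqz 2)]
      refine (norm_sub_le _ _).trans ?_
      rw [norm_mul]
      have hρq : ρ z ≤ ‖q.evalAt z‖ / c := by
        rw [le_div_iff₀ hc, mul_comm]; exact hq z hz
      calc _ ≤ N * (C * ρ z * ‖y - x‖) * ‖q.evalAt z‖ + N * (C * ρ z ^ 2 * ‖y - x‖) :=
            add_le_add (mul_le_mul_of_nonneg_right h1 hqz.le) h2
        _ ≤ N * (C * (‖q.evalAt z‖ / c) * ‖y - x‖) * ‖q.evalAt z‖ +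
            N * (C * (‖q.evalAt z‖ / c) ^ 2 * ‖y - x‖) := by gcongr
        _ = N * (C / c + C / c ^ 2) * ‖y - x‖ * ‖q.evalAt z‖ ^ 2 := by
            field_simp
    have := norm_image_sub_le_of_norm_deriv_le_segment_01' hderiv hbound
    simp only [hu1, hu0] at this
    refine this.trans (mul_le_mul_of_nonneg_right ?_ (norm_nonneg _))
    exact le_add_of_nonneg_left (by positivity)

/-! ### The trivialising vector field -/

theorem eval_zero_eq_zero_of_family {Δ : Set ℂ} (hΔ : IsOpen Δ) {f g : MvPolynomial (Fin n) ℂ}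
    (h0 : ∀ t ∈ Δ, MvPolynomial.eval 0 (f + MvPolynomial.C t * g) = 0) {t₀ : ℂ} (ht₀ : t₀ ∈ Δ) :
    MvPolynomial.eval 0 g = 0 := by
  obtain ⟨ε, hε, hball⟩ := Metric.isOpen_iff.1 hΔ t₀ ht₀
  have hmem : t₀ + ((ε / 2 : ℝ) : ℂ) ∈ Δ := hball (by
    rw [Metric.mem_ball, dist_eq_norm, add_sub_cancel_left, Complex.norm_real,
      Real.norm_of_nonneg (by positivity)]
    exact half_lt_self hε)
  have h1 := h0 t₀ ht₀
  have h2 := h0 _ hmem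
  simp only [map_add, map_mul, MvPolynomial.eval_C] at h1 h2
  have h3 : ((ε / 2 : ℝ) : ℂ) * MvPolynomial.eval 0 g = 0 := by linear_combination h2 - h1
  exact (mul_eq_zero.1 h3).resolve_left (Complex.ofReal_ne_zero.2 (half_pos hε).ne')

theorem totalExp_ne_zero_of_mem_support_toMixed {g : MvPolynomial (Fin n) ℂ}
    (hg : MvPolynomial.eval 0 g = 0) {m : (Fin n ⊕ Fin n) →₀ ℕ} (hm : m ∈ (toMixed g).support) :
    ∃ j, totalExp m j ≠ 0 := by
  by_contra! h
  have hm0 : m = 0 := by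
    ext k
    rcases k with i | i
    · exact (Nat.add_eq_zero_iff.1 (h i)).1
    · exact (Nat.add_eq_zero_iff.1 (h i)).2
  rw [hm0, MvPolynomial.mem_support_iff, ← MvPolynomial.constantCoeff_eq, toMixed,
    MvPolynomial.constantCoeff_rename, ← MvPolynomial.eval_zero] at hm
  exact hm hg

/-- The trivialising vector field: its components are `-g Pᵢ / h`. Its value at the origin is `0`,
whether or not `h` vanishes there, as soon as `g` vanishes at the origin. -/
def trivField (g : MvPolynomial (Fin n) ℂ) (P : Fin n → ℂ → MixedPoly n) (h : ℂ → MixedPoly n)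
    (t : ℂ) (x : Fin n → ℂ) : Fin n → ℂ :=
  fun i => -((toMixed g * P i t).evalAt x / (h t).evalAt x)

/-- The numerators of the vector field against the control function: sizes of the function, of its
first derivatives, and of its products with first derivatives of `h`. -/
theorem exists_numerator_bounds {Δ : Set ℂ} {g : MvPolynomial (Fin n) ℂ}
    (hg : MvPolynomial.eval 0 g = 0) {P h : ℂ → MixedPoly n} (hP : IsAnalyticFamily Δ P)
    (h_analytic : IsAnalyticFamily Δ h) {h₀ : MixedPoly n} (hh₀ : h₀ ≠ 0)
    (hne : (familySupport Δ h).Nonempty)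
    (haxis : ∀ i, ∃ k : ℕ, Pi.single i k ∈ familySupport Δ h)
    (habove : ∀ β ∈ familySupport Δ h, LiesAbove (mixedSupport h₀ : Set (Fin n → ℕ)) (realExp β))
    (hsub : ∀ a ∈ mixedSupport (toMixed g), ∀ b ∈ familySupport Δ P,
      IsSubordinate (familySupport Δ h) (a + b))
    {K : Set ℂ} (hK : IsCompact K) (hKΔ : K ⊆ Δ) :
    ∃ C : ℝ, 0 ≤ C ∧ ∀ t ∈ K, ∀ x : Fin n → ℂ, ‖x‖ < 1 →
      ‖(toMixed g * P t).evalAt x‖ ≤ C * (‖x‖ * rho h₀ x) ∧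
      (∀ k, ‖MixedPoly.evalAt (MvPolynomial.pderiv k (toMixed g * P t)) x‖ ≤ C * rho h₀ x) ∧
      ∀ k, ‖(toMixed g * P t).evalAt x * MixedPoly.evalAt (MvPolynomial.pderiv k (h t)) x‖ ≤
        C * rho h₀ x ^ 2 := by
  classical
  have hA := h_analytic.finite_familySupport
  have hQ : IsAnalyticFamily Δ (fun t => toMixed g * P t) := (IsAnalyticFamily.const _).mul hP
  have hQsupp : ∀ t ∈ Δ, ∀ m ∈ (toMixed g * P t).support,
      IsSubordinate (familySupport Δ h) (totalExp m) ∧ ∃ j, totalExp m j ≠ 0 := by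
    intro t ht m hm
    obtain ⟨a, ha, b, hb, rfl⟩ := Finset.mem_add.1 (MvPolynomial.support_mul _ _ hm)
    rw [totalExp_add]
    obtain ⟨j, hj⟩ := totalExp_ne_zero_of_mem_support_toMixed hg ha
    refine ⟨hsub _ (totalExp_mem_mixedSupport ha) _ ⟨t, ht, totalExp_mem_mixedSupport hb⟩, j, ?_⟩
    rw [Pi.add_apply]
    omega
  have hder : ∀ {p : MixedPoly n} {k : Fin n ⊕ Fin n} {m : (Fin n ⊕ Fin n) →₀ ℕ},
      m ∈ (MvPolynomial.pderiv k p).support → ∃ m' ∈ p.support,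
        totalExp m' (Sum.elim id id k) ≠ 0 ∧
          totalExp m = totalExp m' - Pi.single (Sum.elim id id k) 1 := by
    intro p k m hm
    refine ⟨_, add_single_mem_support_of_mem_support_pderiv hm, ?_, ?_⟩
    · rw [totalExp_add, totalExp_single, Pi.add_apply, Pi.single_eq_same]
      omega
    · rw [totalExp_add, totalExp_single, add_tsub_cancel_right]
  have hsing : ∀ {e : Fin n → ℕ} {j : Fin n} {x : Fin n → ℂ}, ‖x‖ < 1 →
      IsSubordinate (familySupport Δ h) e → e j ≠ 0 →
      ∏ i, ‖x i‖ ^ (e - Pi.single j 1 : Fin n → ℕ) i ≤ rho h₀ x := fun hx he hj =>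
    prod_norm_pow_le_rho hh₀ (LiesAbove.trans habove (he.liesAbove_sub_single hA hne haxis hj)) hx
  obtain ⟨C₀, hC₀, hb₀⟩ := hQ.exists_norm_evalAt_le hK hKΔ
  choose C₁ hC₁ hb₁ using fun k => (hQ.pderiv k).exists_norm_evalAt_le hK hKΔ
  choose C₂ hC₂ hb₂ using fun k => (hQ.mul (h_analytic.pderiv k)).exists_norm_evalAt_le hK hKΔ
  have hs₁ : ∀ k, C₁ k ≤ ∑ k, C₁ k := fun k =>
    Finset.single_le_sum (fun k _ => hC₁ k) (Finset.mem_univ k)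
  have hs₂ : ∀ k, C₂ k ≤ ∑ k, C₂ k := fun k =>
    Finset.single_le_sum (fun k _ => hC₂ k) (Finset.mem_univ k)
  have hS₁ : 0 ≤ ∑ k, C₁ k := Finset.sum_nonneg fun k _ => hC₁ k
  have hS₂ : 0 ≤ ∑ k, C₂ k := Finset.sum_nonneg fun k _ => hC₂ k
  refine ⟨C₀ + ∑ k, C₁ k + ∑ k, C₂ k, by positivity, fun t ht x hx => ?_⟩
  have hρ := rho_nonneg h₀ x
  refine ⟨?_, fun k => ?_, fun k => ?_⟩
  · refine (hb₀ t ht x (‖x‖ * rho h₀ x) (by positivity) fun m hm => ?_).trans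
      (mul_le_mul_of_nonneg_right (by linarith) (by positivity))
    obtain ⟨he, j, hj⟩ := hQsupp t (hKΔ ht) m hm
    rw [prod_norm_pow_eq_mul hj]
    exact mul_le_mul (norm_le_pi_norm x j) (hsing hx he hj)
      (Finset.prod_nonneg fun _ _ => by positivity) (norm_nonneg _)
  · refine (hb₁ k t ht x (rho h₀ x) hρ fun m hm => ?_).trans
      (mul_le_mul_of_nonneg_right (by linarith [hs₁ k]) hρ)
    obtain ⟨m', hm', hj, heq⟩ := hder hm
    rw [heq]
    exact hsing hx (hQsupp t (hKΔ ht) m' hm').1 hj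
  · rw [← evalAt_mul]
    refine (hb₂ k t ht x (rho h₀ x ^ 2) (by positivity) fun m hm => ?_).trans
      (mul_le_mul_of_nonneg_right (by linarith [hs₂ k]) (by positivity))
    obtain ⟨m₁, hm₁, m₂, hm₂, rfl⟩ := Finset.mem_add.1 (MvPolynomial.support_mul _ _ hm)
    obtain ⟨m', hm', hj, heq⟩ := hder hm₂
    rw [totalExp_add, heq]
    exact prod_norm_pow_le_rho_pow hh₀ two_ne_zero (LiesAbove.trans habove
      ((hQsupp t (hKΔ ht) m₁ hm₁).1.liesAbove_half hA hne haxis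
        ⟨t, hKΔ ht, totalExp_mem_mixedSupport hm'⟩ hj)) hx

/-- The lower bound `|h_t| ≥ c ρ` at one parameter persists, with one constant, for nearby
parameters, because all monomials of the family are bounded by `ρ`. -/
theorem exists_uniform_lower_bound {Δ : Set ℂ} (hΔ : IsOpen Δ) {h : ℂ → MixedPoly n}
    (h_analytic : IsAnalyticFamily Δ h) {t₀ : ℂ} (ht₀ : t₀ ∈ Δ)
    (hcontrol : IsControlFunction (h t₀))
    (habove : ∀ β ∈ familySupport Δ h,
      LiesAbove (mixedSupport (h t₀) : Set (Fin n → ℕ)) (realExp β)) :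
    ∃ c : ℝ, 0 < c ∧ ∃ r : ℝ, 0 < r ∧ r < 1 ∧ ∀ᶠ t in 𝓝 t₀,
      ∀ x ∈ Metric.closedBall (0 : Fin n → ℂ) r, c * rho (h t₀) x ≤ ‖(h t).evalAt x‖ := by
  obtain ⟨hh₀, -, -, hO⟩ := hcontrol
  obtain ⟨C, hC, hCw⟩ := hO.exists_pos
  obtain ⟨r, hr, hball⟩ := Metric.nhds_basis_closedBall.eventually_iff.1 hCw.bound
  refine ⟨1 / (2 * C), by positivity, min r (1 / 2), by positivity,
    (min_le_right _ _).trans_lt (by norm_num), ?_⟩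
  filter_upwards [h_analytic.eventually_norm_evalAt_sub_le hΔ ht₀ (ε := 1 / (2 * C))
    (by positivity)] with t ht x hx
  have hx' := Metric.mem_closedBall.1 hx
  rw [dist_zero_right] at hx'
  have hx1 : ‖x‖ < 1 := hx'.trans_lt ((min_le_right _ _).trans_lt (by norm_num))
  have hρ := rho_nonneg (h t₀) x
  have h1 := ht x (rho (h t₀) x) hρ fun s hs m hm =>
    prod_norm_pow_le_rho hh₀ (habove _ ⟨s, hs, totalExp_mem_mixedSupport hm⟩) hx1
  have h2 := hball (Metric.closedBall_subset_closedBall (min_le_left _ _) hx)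
  rw [Real.norm_of_nonneg hρ] at h2
  have h3 : 1 / C * rho (h t₀) x ≤ ‖(h t₀).evalAt x‖ := by
    rw [one_div, inv_mul_le_iff₀ hC]
    exact h2
  have h4 : ‖(h t₀).evalAt x‖ - ‖(h t).evalAt x‖ ≤ 1 / (2 * C) * rho (h t₀) x := by
    refine (norm_sub_norm_le _ _).trans ?_
    rwa [norm_sub_rev]
  have h5 : 1 / C * rho (h t₀) x = 1 / (2 * C) * rho (h t₀) x + 1 / (2 * C) * rho (h t₀) x := by
    field_simp
    norm_num
  linarith

/-- Along the trivialising field the total derivative of the family vanishes: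
`∂F/∂t + ∑ Xₖ ∂F/∂xₖ = g - g (∑ Pₖ ∂F/∂xₖ) / h = 0`. -/
theorem eval_add_sum_trivField {g F : MvPolynomial (Fin n) ℂ} {P : Fin n → ℂ → MixedPoly n}
    {h : ℂ → MixedPoly n} {t : ℂ} (h_form : h t = ∑ i, P i t * toMixed (MvPolynomial.pderiv i F))
    {x : Fin n → ℂ} (hx : (h t).evalAt x = 0 → MvPolynomial.eval x g = 0) :
    MvPolynomial.eval x g +
      ∑ k, MvPolynomial.eval x (MvPolynomial.pderiv k F) * trivField g P h t x k = 0 := by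
  have hsum : (h t).evalAt x =
      ∑ k, (P k t).evalAt x * MvPolynomial.eval x (MvPolynomial.pderiv k F) := by
    rw [h_form, MixedPoly.evalAt, map_sum]
    exact Finset.sum_congr rfl fun k _ => by
      rw [← evalAt_toMixed, ← evalAt_mul, MixedPoly.evalAt]
  have hfield : ∑ k, MvPolynomial.eval x (MvPolynomial.pderiv k F) * trivField g P h t x k =
      -(MvPolynomial.eval x g * (h t).evalAt x / (h t).evalAt x) := by
    calc _ = ∑ k, -(MvPolynomial.eval x g / (h t).evalAt x) *
          ((P k t).evalAt x * MvPolynomial.eval x (MvPolynomial.pderiv k F)) := by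
          refine Finset.sum_congr rfl fun k _ => ?_
          rw [trivField, evalAt_mul, evalAt_toMixed]
          ring
      _ = -(MvPolynomial.eval x g / (h t).evalAt x) * (h t).evalAt x := by
          rw [← Finset.mul_sum, ← hsum]
      _ = _ := by ring
  rw [hfield]
  by_cases h0 : (h t).evalAt x = 0
  · simp [hx h0]
  · rw [mul_div_cancel_right₀ _ h0, add_neg_cancel]

/-- The family is constant along integral curves on which its total derivative vanishes. -/
theorem eval_eq_of_integralCurve {f g : MvPolynomial (Fin n) ℂ} {F : ℂ → MvPolynomial (Fin n) ℂ}
    (hF : ∀ t, F t = f + MvPolynomial.C t * g) {X : ℂ → (Fin n → ℂ) → Fin n → ℂ} {t₀ t : ℂ}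
    {y : ℝ → Fin n → ℂ}
    (hy : IsIntegralCurveOn y (fun τ x => (t - t₀) • X (t₀ + (τ : ℂ) * (t - t₀)) x)
      (Set.Icc 0 1))
    (hX : ∀ τ ∈ Set.Icc (0 : ℝ) 1, MvPolynomial.eval (y τ) g +
      ∑ k, MvPolynomial.eval (y τ) (MvPolynomial.pderiv k (F (t₀ + (τ : ℂ) * (t - t₀)))) *
        X (t₀ + (τ : ℂ) * (t - t₀)) (y τ) k = 0) :
    MvPolynomial.eval (y 1) (F t) = MvPolynomial.eval (y 0) (F t₀) := by
  set G : ℝ → ℂ := fun τ => MvPolynomial.eval (y τ) f +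
    (t₀ + (τ : ℂ) * (t - t₀)) * MvPolynomial.eval (y τ) g with hG
  have hderiv : ∀ τ ∈ Set.Icc (0 : ℝ) 1, HasDerivWithinAt G 0 (Set.Icc 0 1) τ := by
    intro τ hτ
    have ht : HasDerivWithinAt (fun τ : ℝ => t₀ + (τ : ℂ) * (t - t₀)) (t - t₀) (Set.Icc 0 1) τ := by
      have := ((Complex.ofRealCLM.hasDerivAt (x := τ)).mul_const (t - t₀)).const_add t₀
      simpa using this.hasDerivWithinAt
    have h1 := (hasDerivWithinAt_eval f (hy τ hτ)).add
      (ht.mul (hasDerivWithinAt_eval g (hy τ hτ)))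
    refine h1.congr_deriv ?_
    have h2 := congrArg (fun z => (t - t₀) * z) (hX τ hτ)
    beta_reduce at h2 ⊢
    generalize t₀ + (τ : ℂ) * (t - t₀) = s at h2 ⊢
    simp only [hF, map_add, map_mul, MvPolynomial.pderiv_C_mul, MvPolynomial.eval_C, mul_zero] at h2
    rw [← h2, Finset.mul_sum, mul_add, Finset.mul_sum, add_left_comm, ← Finset.sum_add_distrib]
    congr 1
    refine Finset.sum_congr rfl fun k _ => ?_
    simp only [Pi.smul_apply, smul_eq_mul]
    ring
  have hconst := constant_of_has_deriv_right_zero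
    (fun τ hτ => (hderiv τ hτ).continuousWithinAt)
    (fun τ hτ => (hderiv τ (Set.Ico_subset_Icc_self hτ)).mono_of_mem_nhdsWithin
      (Icc_mem_nhdsGE_of_mem hτ)) 1 (Set.right_mem_Icc.2 zero_le_one)
  simpa [hG, hF] using hconst

/-- The bound by a multiple of the norm gives continuity at the origin, where the denominator may
vanish. -/
theorem continuousOn_trivField {Δ V : Set ℂ} {r M : ℝ} (hVΔ : V ⊆ Δ)
    {g : MvPolynomial (Fin n) ℂ} {P : Fin n → ℂ → MixedPoly n} {h : ℂ → MixedPoly n}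
    (hP : ∀ i, IsAnalyticFamily Δ (P i)) (h_analytic : IsAnalyticFamily Δ h)
    (hne : ∀ t ∈ V, ∀ x ∈ Metric.closedBall (0 : Fin n → ℂ) r, x ≠ 0 → (h t).evalAt x ≠ 0)
    (hM : ∀ t ∈ V, ∀ x ∈ Metric.closedBall (0 : Fin n → ℂ) r, ∀ i,
      ‖trivField g P h t x i‖ ≤ M * ‖x‖) :
    ContinuousOn (fun q : ℂ × (Fin n → ℂ) => trivField g P h q.1 q.2)
      (V ×ˢ Metric.closedBall 0 r) := by
  have hsub : V ×ˢ Metric.closedBall (0 : Fin n → ℂ) r ⊆ Δ ×ˢ Set.univ :=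
    Set.prod_mono hVΔ (Set.subset_univ _)
  refine continuousOn_pi.2 fun i => ?_
  rintro ⟨t, x⟩ hq
  by_cases hx : x = 0
  · subst hx
    have h0 : trivField g P h t 0 i = 0 := by
      have := hM t hq.1 0 hq.2 i
      rwa [norm_zero, mul_zero, norm_le_zero_iff] at this
    rw [ContinuousWithinAt]
    simp only [h0]
    refine squeeze_zero_norm' (a := fun q : ℂ × (Fin n → ℂ) => M * ‖q.2‖) ?_ ?_
    · filter_upwards [self_mem_nhdsWithin] with q hq'
      exact hM q.1 hq'.1 q.2 hq'.2 i
    · have hc : Continuous fun q : ℂ × (Fin n → ℂ) => M * ‖q.2‖ := by fun_prop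
      have := (hc.tendsto (t, 0)).mono_left
        (nhdsWithin_le_nhds (s := V ×ˢ Metric.closedBall (0 : Fin n → ℂ) r))
      simpa using this
  · have hnum := (((IsAnalyticFamily.const (toMixed g)).mul (hP i)).continuousOn_evalAt.mono hsub)
      (t, x) hq
    exact (hnum.div ((h_analytic.continuousOn_evalAt.mono hsub) (t, x) hq)
      (hne t hq.1 x hq.2 hx)).neg

end LipNewton

end

theorem mainTheorem7 {n : ℕ} (Δ : Set ℂ) (hΔ : IsOpen Δ)
    (f g : MvPolynomial (Fin n) ℂ) (F : ℂ → MvPolynomial (Fin n) ℂ)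
    (hF : ∀ t, F t = f + MvPolynomial.C t * g)
    (hF_zero : ∀ t ∈ Δ, MvPolynomial.eval 0 (F t) = 0)
    (hF_isolated : ∀ t ∈ Δ, LipNewton.HasIsolatedSingularity (F t))
    (hF_diagram : ∀ s ∈ Δ, ∀ t ∈ Δ,
      LipNewton.newtonDiagram (LipNewton.mixedSupport (LipNewton.toMixed (F s)) : Set (Fin n → ℕ)) =
      LipNewton.newtonDiagram (LipNewton.mixedSupport (LipNewton.toMixed (F t)) : Set (Fin n → ℕ)))
    (P : Fin n → ℂ → LipNewton.MixedPoly n)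
    (hP : ∀ i, LipNewton.IsAnalyticFamily Δ (P i))
    (h : ℂ → LipNewton.MixedPoly n)
    (h_analytic : LipNewton.IsAnalyticFamily Δ h)
    (h_control : ∀ t ∈ Δ, LipNewton.IsControlFunction (h t))
    (h_form : ∀ t ∈ Δ, h t = ∑ i, P i t * LipNewton.toMixed (MvPolynomial.pderiv i (F t)))
    (h_diagram : ∀ s ∈ Δ, ∀ t ∈ Δ,
      LipNewton.newtonDiagram (LipNewton.mixedSupport (h s) : Set (Fin n → ℕ)) =
      LipNewton.newtonDiagram (LipNewton.mixedSupport (h t) : Set (Fin n → ℕ)))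
    (h_fil : ∀ σ, LipNewton.IsCompactFacet (LipNewton.familySupport Δ h) σ →
      ∃ w, LipNewton.IsWeight σ w ∧ ∀ i,
        0 ≤ LipNewton.fil w (LipNewton.mixedSupport (LipNewton.toMixed g) : Set (Fin n → ℕ))
          + LipNewton.fil w (LipNewton.familySupport Δ (P i))
          - LipNewton.fil w (LipNewton.familySupport Δ h)
          - LipNewton.maxWeight w) :
    LipNewton.IsLipschitzTrivial Δ (fun t x => MvPolynomial.eval x (F t)) := by
  open LipNewton in
  intro t₀ ht₀
  have hg0 : MvPolynomial.eval 0 g = 0 :=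
    eval_zero_eq_zero_of_family hΔ (fun t ht => hF t ▸ hF_zero t ht) ht₀
  have hcontrol := h_control t₀ ht₀
  have hh₀ : h t₀ ≠ 0 := hcontrol.1
  have hmem₀ : ∀ {α : Fin n → ℕ}, α ∈ (mixedSupport (h t₀) : Set (Fin n → ℕ)) →
      α ∈ familySupport Δ h := fun hα => ⟨t₀, ht₀, hα⟩
  have hne : (familySupport Δ h).Nonempty := (mixedSupport_nonempty hh₀).mono fun _ => hmem₀
  have haxis : ∀ i, ∃ k : ℕ, Pi.single i k ∈ familySupport Δ h := fun i =>
    (hcontrol.2.1.exists_single_mem i).imp fun _ => hmem₀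
  have hA := h_analytic.finite_familySupport
  have habove : ∀ β ∈ familySupport Δ h,
      LiesAbove (mixedSupport (h t₀) : Set (Fin n → ℕ)) (realExp β) := by
    rintro β ⟨t, ht, hβ⟩
    exact LiesAbove.of_newtonDiagram_eq (Finset.finite_toSet _) (mixedSupport_nonempty hh₀)
      (Finset.finite_toSet _) (h_diagram t ht t₀ ht₀) hβ
  have hsub : ∀ i, ∀ a ∈ mixedSupport (toMixed g), ∀ b ∈ familySupport Δ (P i),
      IsSubordinate (familySupport Δ h) (a + b) := fun i a ha b hb =>
    IsSubordinate.of_fil hA hne (fun σ hσ => (h_fil σ hσ).imp fun w hw => ⟨hw.1, hw.2 i⟩) ha hb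
  obtain ⟨c, hc, r, hr, hr1, hlow⟩ :=
    exists_uniform_lower_bound hΔ h_analytic ht₀ hcontrol habove
  -- A closed disc around `t₀`, of radius at most `1`, inside `Δ` and where the lower bound holds.
  obtain ⟨δ₀, hδ₀, hδ₀sub⟩ := Metric.nhds_basis_closedBall.mem_iff.1
    (inter_mem (hΔ.mem_nhds ht₀) hlow)
  set δ := min δ₀ 1 with hδ
  have hδpos : 0 < δ := lt_min hδ₀ one_pos
  have hK : Metric.closedBall t₀ δ ⊆ Metric.closedBall t₀ δ₀ :=
    Metric.closedBall_subset_closedBall (min_le_left _ _)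
  have hKΔ : Metric.closedBall t₀ δ ⊆ Δ := fun t ht => (hδ₀sub (hK ht)).1
  have hVK : Metric.ball t₀ δ ⊆ Metric.closedBall t₀ δ := Metric.ball_subset_closedBall
  have hq : ∀ t ∈ Metric.ball t₀ δ, ∀ x ∈ Metric.closedBall (0 : Fin n → ℂ) r,
      c * rho (h t₀) x ≤ ‖(h t).evalAt x‖ := fun t ht => (hδ₀sub (hK (hVK ht))).2
  have hlt1 : ∀ x ∈ Metric.closedBall (0 : Fin n → ℂ) r, ‖x‖ < 1 := fun x hx =>
    (mem_closedBall_zero_iff.1 hx).trans_lt hr1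
  have hρ : ∀ x ∈ Metric.closedBall (0 : Fin n → ℂ) r, x ≠ 0 → 0 < rho (h t₀) x := fun x hx =>
    rho_pos hh₀ hcontrol.2.1 (hlt1 x hx)
  have hhne : ∀ t ∈ Metric.ball t₀ δ, ∀ x ∈ Metric.closedBall (0 : Fin n → ℂ) r, x ≠ 0 →
      (h t).evalAt x ≠ 0 := fun t ht x hx hx0 =>
    norm_pos_iff.1 ((mul_pos hc (hρ x hx hx0)).trans_le (hq t ht x hx))
  choose C hC hbd using fun i => exists_numerator_bounds hg0 (hP i) h_analytic hh₀ hne haxis habove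
    (hsub i) (isCompact_closedBall t₀ δ) hKΔ
  set D := ∑ i, C i with hD
  have hCD : ∀ i, C i ≤ D := fun i => Finset.single_le_sum (fun i _ => hC i) (Finset.mem_univ i)
  have hD0 : 0 ≤ D := Finset.sum_nonneg fun i _ => hC i
  have hsmall : ∀ t ∈ Metric.ball t₀ δ, ∀ x ∈ Metric.closedBall (0 : Fin n → ℂ) r, ∀ i,
      ‖trivField g P h t x i‖ ≤ D / c * ‖x‖ := by
    intro t ht x hx i
    have hρ0 := rho_nonneg (h t₀) x
    rw [trivField, norm_neg]
    exact norm_evalAt_div_le hc (hρ x hx) (hq t ht x hx)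
      (((hbd i t (hVK ht) x (hlt1 x hx)).1).trans
        (mul_le_mul_of_nonneg_right (hCD i) (by positivity)))
  set M : ℝ := D / c + Fintype.card (Fin n ⊕ Fin n) * (D / c + D / c ^ 2) with hM
  have hM0 : 0 ≤ M := by positivity
  have hlip : ∀ t ∈ Metric.ball t₀ δ,
      LipschitzOnWith M.toNNReal (trivField g P h t) (Metric.closedBall 0 r) := by
    intro t ht
    refine LipschitzOnWith.of_dist_le_mul fun x hx y hy => ?_
    rw [Real.coe_toNNReal _ hM0, dist_pi_le_iff (by positivity)]
    intro i
    rw [dist_comm x y, dist_comm, dist_eq_norm, dist_eq_norm, trivField, trivField, neg_sub_neg,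
      norm_sub_rev]
    refine norm_evalAt_div_sub_le hc hD0 hρ (hq t ht) (fun z hz => ?_) (fun k z hz => ?_)
      (fun k z hz => ?_) hx hy
    all_goals
      have hρ0 := rho_nonneg (h t₀) z
      obtain ⟨h1, h2, h3⟩ := hbd i t (hVK ht) z (hlt1 z hz)
    · exact h1.trans (mul_le_mul_of_nonneg_right (hCD i) (by positivity))
    · exact (h2 k).trans (mul_le_mul_of_nonneg_right (hCD i) hρ0)
    · exact (h3 k).trans (mul_le_mul_of_nonneg_right (hCD i) (by positivity))
  have hX0 : ∀ t ∈ Metric.ball t₀ δ, trivField g P h t 0 = 0 := by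
    intro t ht
    ext i
    simpa using hsmall t ht 0 (Metric.mem_closedBall_self hr.le) i
  obtain ⟨W, hWo, hW0, φ, hφc, hφ, hcurve⟩ := exists_isBiLipschitzGerm_family (min_le_right _ _) hr
    (continuousOn_trivField (hVK.trans hKΔ) hP h_analytic hhne hsmall) hlip hX0
  refine ⟨Metric.ball t₀ δ, Metric.isOpen_ball, Metric.mem_ball_self hδpos, hVK.trans hKΔ, W, hWo,
    hW0, φ, hφc, hφ, fun t ht x hx => ?_⟩
  obtain ⟨y, hy0, hy1, hyr, hy⟩ := hcurve t ht x hx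
  rw [← hy1, ← hy0]
  refine eval_eq_of_integralCurve hF hy fun τ hτ => ?_
  have htτ : t₀ + (τ : ℂ) * (t - t₀) ∈ Metric.ball t₀ δ := by
    rw [mem_ball_iff_norm, add_sub_cancel_left, norm_mul, Complex.norm_real,
      Real.norm_of_nonneg hτ.1]
    exact (mul_le_of_le_one_left (norm_nonneg _) hτ.2).trans_lt (mem_ball_iff_norm.1 ht)
  refine eval_add_sum_trivField (h_form _ (hKΔ (hVK htτ))) fun hzero => ?_
  have : y τ = 0 := by
    by_contra hne0
    exact hhne _ htτ _ (hyr τ hτ) hne0 hzero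
  rw [this, hg0]
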